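/- Let $H_+=\{z\in\mathbb{C}:\operatorname{Im}z>0\}$, and let $\mathcal{O}(H_+)$ and $\mathcal{O}(H_+\times H_+)$ be the spaces of holomorphic functions on $H_+$ and on $H_+\times H_+$, with the topology of locally uniform convergence. For $\lambda\in\mathbb{C}$ let $\pi_\lambda$ be the representation of the universal covering group $\mathrm{SL}(2,\mathbb{R})^{\sim}$ on $\mathcal{O}(H_+)$ given by $$(\pi_\lambda(g)f)(z)=(cz+d)^{-\lambda}f\Big(\frac{az+b}{cz+d}\Big),$$ where $g^{-1}$ lies over $\begin{pmatrix}a&b\\c&d\end{pmatrix}\in\mathrm{SL}(2,\mathbb{R})$ and $(cz+d)^{-\lambda}=e^{-\lambda\varphi(z)}$ for the holomorphic branch $\varphi$ of $\log(cz+d)$ on $H_+$ determined by $g^{-1}$ (elements of $\mathrm{SL}(2,\mathbb{R})^{\sim}$ being identified with pairs consisting of a matrix in $\mathrm{SL}(2,\mathbb{R})$ and such a branch). For $\lambda_1,\lambda_2,\lambda_3\in\mathbb{C}$ let $H(\lambda_1,\lambda_2,\lambda_3)$ be the complex vector space of all continuous linear maps $T:\mathcal{O}(H_+\times H_+)\to\mathcal{O}(H_+)$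 that intertwine $\pi_{\lambda_1}\otimes\pi_{\lambda_2}$ (with $\mathrm{SL}(2,\mathbb{R})^{\sim}$ acting diagonally) and $\pi_{\lambda_3}$. Put $$\Omega=\{(\lambda_1,\lambda_2,\lambda_3)\in\mathbb{C}^3:\lambda_3-\lambda_1-\lambda_2\in\{0,2,4,\dots\}\},$$ $$\Omega_{\mathrm{sing}}=\{(\lambda_1,\lambda_2,\lambda_3)\in\Omega:\lambda_1,\lambda_2,\lambda_3\in\mathbb{Z},\ \lambda_3-|\lambda_1-\lambda_2|\ge 2\ge\lambda_1+\lambda_2+\lambda_3\}.$$ For $(\lambda_1,\lambda_2,\lambda_3)\in\Omega$ and $a=\frac12(\lambda_3-\lambda_1-\lambda_2)$ define $\mathcal{RC}_{\lambda_1,\lambda_2}^{\lambda_3}:\mathcal{O}(H_+\times H_+)\to\mathcal{O}(H_+)$ by $$(\mathcal{RC}_{\lambda_1,\lambda_2}^{\lambda_3}f)(z)=\sum_{l=0}^{a}\frac{(-1)^l}{l!\,(a-l)!}\,\frac{\Gamma(\lambda_1+a)\,\Gamma(\lambda_2+a)}{\Gamma(\lambda_1+a-l)\,\Gamma(\lambda_2+l)}\,\frac{\partial^{a}f}{\partial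 z_1^{a-l}\partial z_2^{l}}(z,z),$$ where the quotients of Gamma functions are continued holomorphically to all $\lambda_1,\lambda_2$, that is, $\Gamma(\lambda_1+a)/\Gamma(\lambda_1+a-l)=\prod_{j=0}^{l-1}(\lambda_1+a-l+j)$ and $\Gamma(\lambda_2+a)/\Gamma(\lambda_2+l)=\prod_{j=0}^{a-l-1}(\lambda_2+l+j)$. **Theorem.** Let $\lambda_1,\lambda_2,\lambda_3\in\mathbb{C}$. 1. $H(\lambda_1,\lambda_2,\lambda_3)\neq\{0\}$ if and only if $(\lambda_1,\lambda_2,\lambda_3)\in\Omega$. 2. Suppose $(\lambda_1,\lambda_2,\lambda_3)\in\Omega$. The conditions $\dim_{\mathbb{C}}H(\lambda_1,\lambda_2,\lambda_3)=1$, $\mathcal{RC}_{\lambda_1,\lambda_2}^{\lambda_3}\neq0$, and $(\lambda_1,\lambda_2,\lambda_3)\notin\Omega_{\mathrm{sing}}$ are equivalent. If they hold, then $H(\lambda_1,\lambda_2,\lambda_3)=\mathbb{C}\,\mathcal{RC}_{\lambda_1,\lambda_2}^{\lambda_3}$. 3. Suppose $(\lambda_1,\lambda_2,\lambda_3)\in\Omega$.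 The conditions $\dim_{\mathbb{C}}H(\lambda_1,\lambda_2,\lambda_3)=2$, $\mathcal{RC}_{\lambda_1,\lambda_2}^{\lambda_3}=0$, and $(\lambda_1,\lambda_2,\lambda_3)\in\Omega_{\mathrm{sing}}$ are equivalent. If they hold, then $1-\lambda_1$ and $1-\lambda_2$ are nonnegative integers, $(2-\lambda_1,\lambda_2,\lambda_3)$ and $(\lambda_1,2-\lambda_2,\lambda_3)$ belong to $\Omega$, and $H(\lambda_1,\lambda_2,\lambda_3)$ is spanned by $$\mathcal{RC}_{2-\lambda_1,\lambda_2}^{\lambda_3}\circ\Big(\frac{\partial}{\partial z_1}\Big)^{1-\lambda_1}\quad\text{and}\quad\mathcal{RC}_{\lambda_1,2-\lambda_2}^{\lambda_3}\circ\Big(\frac{\partial}{\partial z_2}\Big)^{1-\lambda_2}.$$ 4. In particular, every $T\in H(\lambda_1,\lambda_2,\lambda_3)$ is a holomorphic differential operator: there are $N\in\mathbb{N}$ and $c_{ij}\in\mathcal{O}(H_+)$ for $0\le i,j<N$ such that $(Tf)(z)=\sum_{i,j<N}c_{ij}(z)\,\dfrac{\partial^{i+j}f}{\partial z_1^{i}\partial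 z_2^{j}}(z,z)$ for all $f\in\mathcal{O}(H_+\times H_+)$ and $z\in H_+$. -/

import Mathlib

open UpperHalfPlane
open scoped MatrixGroups

noncomputable section

namespace RankinCohen

/-! ### Spaces of holomorphic functions -/

/-- `f(z)` as a function of a complex variable (only its values for `Im w > 0` matter). -/
def ext1 (f : ℍ → ℂ) : ℂ → ℂ := fun w => f (ofComplex w)

/-- `f(z₁, z₂)` as a function of two complex variables (only its values for `Im w₁, Im w₂ > 0`
matter). -/
def ext2 (f : ℍ × ℍ → ℂ) : ℂ × ℂ → ℂ := fun w => f (ofComplex w.1, ofComplex w.2)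

/-- The open upper half plane as a subset of `ℂ`. -/
def U1 : Set ℂ := {w | 0 < w.im}

/-- The product of two upper half planes as a subset of `ℂ × ℂ`. -/
def U2 : Set (ℂ × ℂ) := {w | 0 < w.1.im ∧ 0 < w.2.im}

/-- `𝒪(H₊)`: the holomorphic functions on the upper half plane. As a subspace of `C(ℍ, ℂ)` with
the compact-open topology it carries the topology of locally uniform convergence. -/
def Hol1 : Submodule ℂ C(ℍ, ℂ) where
  carrier := {f | AnalyticOnNhd ℂ (ext1 f) U1}
  zero_mem' := fun _ _ => analyticAt_const
  add_mem' := fun hf hg w hw => (hf w hw).add (hg w hw)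
  smul_mem' := fun _ _ hf w hw => analyticAt_const.smul (hf w hw)

/-- `𝒪(H₊ × H₊)`: the holomorphic functions of two variables on the product of two upper half
planes, with the topology of locally uniform convergence. -/
def Hol2 : Submodule ℂ C(ℍ × ℍ, ℂ) where
  carrier := {f | AnalyticOnNhd ℂ (ext2 f) U2}
  zero_mem' := fun _ _ => analyticAt_const
  add_mem' := fun hf hg w hw => (hf w hw).add (hg w hw)
  smul_mem' := fun _ _ hf w hw => analyticAt_const.smul (hf w hw)

theorem isOpen_U1 : IsOpen U1 := isOpen_lt continuous_const Complex.continuous_im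

theorem coe_mem_U1 (z : ℍ) : (z : ℂ) ∈ U1 := z.coe_im_pos

theorem coe_mem_U2 (z : ℍ × ℍ) : ((z.1 : ℂ), (z.2 : ℂ)) ∈ U2 :=
  ⟨z.1.coe_im_pos, z.2.coe_im_pos⟩

theorem coe_ofComplex {w : ℂ} (hw : w ∈ U1) : ((ofComplex w : ℍ) : ℂ) = w := by
  rw [ofComplex_apply_of_im_pos hw]

theorem isOpen_U2 : IsOpen U2 :=
  (isOpen_U1.preimage continuous_fst).inter (isOpen_U1.preimage continuous_snd)

/-! ### The universal covering group -/

theorem continuous_moebius (g : SL(2, ℝ)) : Continuous fun z : ℍ => g • z :=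
  continuous_const_smul (Matrix.SpecialLinearGroup.mapGL ℝ g)

theorem analyticAt_moebius (g : SL(2, ℝ)) {w : ℂ} (hw : w ∈ U1) :
    AnalyticAt ℂ (fun w => ((g • (ofComplex w) : ℍ) : ℂ)) w := by
  have h := analyticAt_smul (g := Matrix.SpecialLinearGroup.mapGL ℝ g) (by simp) (ofComplex w)
  rw [coe_ofComplex hw] at h
  exact h

/-- `f(z) ↦ f(g z)`. -/
def pull1 (g : SL(2, ℝ)) (f : Hol1) : Hol1 :=
  ⟨⟨fun z => f.1 (g • z), f.1.continuous.comp (continuous_moebius g)⟩, by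
    intro w hw
    have h1 : AnalyticAt ℂ (ext1 f.1) ((g • (ofComplex w) : ℍ) : ℂ) := f.2 _ (coe_mem_U1 _)
    have h := AnalyticAt.fun_comp (f := fun v : ℂ => ((g • (ofComplex v) : ℍ) : ℂ)) h1
      (analyticAt_moebius g hw)
    refine h.congr (Filter.Eventually.of_forall fun v => ?_)
    simp [ext1]⟩

theorem denom_cocycle (g h : SL(2, ℝ)) (z : ℍ) :
    (((g * h) 1 0 : ℝ) : ℂ) * z + ((g * h) 1 1 : ℝ) =
      (((g 1 0 : ℝ) : ℂ) * ((h • z : ℍ) : ℂ) + (g 1 1 : ℝ)) *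
        (((h 1 0 : ℝ) : ℂ) * z + (h 1 1 : ℝ)) := by
  have h0 : ((h 1 0 : ℝ) : ℂ) * z + (h 1 1 : ℝ) ≠ 0 :=
    denom_ne_zero (Matrix.SpecialLinearGroup.mapGL ℝ h) z
  rw [coe_specialLinearGroup_apply]
  simp only [Algebra.algebraMap_self, RingHom.id_apply, Matrix.SpecialLinearGroup.coe_mul,
    Matrix.mul_apply, Fin.sum_univ_two, Complex.ofReal_add, Complex.ofReal_mul]
  field_simp
  ring

/-- The universal covering group of `SL(2, ℝ)`, realized as the set of pairs `(g, φ)` where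
`g ∈ SL(2, ℝ)` has bottom row `(c, d)` and `φ` is a holomorphic branch of `log (c z + d)` on the
upper half plane. The covering map is `(g, φ) ↦ g`, with kernel `{(1, 2πik) : k ∈ ℤ}`. -/
@[ext]
structure SL2Cover where
  mat : SL(2, ℝ)
  log : Hol1
  exp_log : ∀ z : ℍ,
    Complex.exp (log.1 z) = ((mat 1 0 : ℝ) : ℂ) * (z : ℂ) + ((mat 1 1 : ℝ) : ℂ)

namespace SL2Cover

instance : Mul SL2Cover where
  mul g h :=
    { mat := g.mat * h.mat
      log := pull1 h.mat g.log + h.log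
      exp_log := fun z => by
        have hz : (pull1 h.mat g.log + h.log).1 z = g.log.1 (h.mat • z) + h.log.1 z := rfl
        rw [hz, Complex.exp_add, g.exp_log, h.exp_log, denom_cocycle] }

instance : One SL2Cover where
  one :=
    { mat := 1
      log := 0
      exp_log := fun z => by simp }

instance : Inv SL2Cover where
  inv g :=
    { mat := g.mat⁻¹
      log := -pull1 g.mat⁻¹ g.log
      exp_log := fun z => by
        have hz : (-pull1 g.mat⁻¹ g.log).1 z = -g.log.1 (g.mat⁻¹ • z) := rfl
        have h := denom_cocycle g.mat g.mat⁻¹ z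
        rw [mul_inv_cancel] at h
        rw [hz, Complex.exp_neg, g.exp_log]
        refine inv_eq_of_mul_eq_one_right (h.symm.trans ?_)
        simp }

theorem mul_mat (g h : SL2Cover) : (g * h).mat = g.mat * h.mat := rfl

theorem one_mat : (1 : SL2Cover).mat = 1 := rfl

theorem inv_mat (g : SL2Cover) : (g⁻¹).mat = g.mat⁻¹ := rfl

theorem mul_log (g h : SL2Cover) (z : ℍ) :
    (g * h).log.1 z = g.log.1 (h.mat • z) + h.log.1 z := rfl

theorem one_log (z : ℍ) : (1 : SL2Cover).log.1 z = 0 := rfl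

theorem inv_log (g : SL2Cover) (z : ℍ) : (g⁻¹).log.1 z = -g.log.1 (g.mat⁻¹ • z) := rfl

theorem ext_log {g h : SL2Cover} (h1 : g.mat = h.mat) (h2 : ∀ z, g.log.1 z = h.log.1 z) :
    g = h :=
  SL2Cover.ext h1 (Subtype.ext (ContinuousMap.ext h2))

instance : Group SL2Cover :=
  Group.ofLeftAxioms
    (fun a b c => ext_log (mul_assoc _ _ _) fun z => by
      simp only [mul_log, mul_mat, mul_smul, add_assoc])
    (fun a => ext_log (one_mul _) fun z => by simp only [mul_log, one_log, zero_add])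
    (fun a => ext_log (inv_mul_cancel _) fun z => by
      simp only [mul_log, inv_log, one_log, inv_smul_smul, neg_add_cancel])

end SL2Cover

/-! ### The representations -/

/-- `f(z) ↦ (c z + d) ^ (-lam) f((a z + b) / (c z + d))`, where `h` lies over the matrix with
rows `(a, b)`, `(c, d)` and `(c z + d) ^ (-lam) = exp (-lam φ(z))` for the branch `φ` of
`log (c z + d)` that belongs to `h`. -/
def slash1 (lam : ℂ) (h : SL2Cover) : Hol1 →ₗ[ℂ] Hol1 where
  toFun f := ⟨⟨fun z => Complex.exp (-lam * h.log.1 z) * f.1 (h.mat • z), by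
    have h1 := h.log.1.continuous
    have h2 := f.1.continuous.comp (continuous_moebius h.mat)
    exact (Complex.continuous_exp.comp (continuous_const.mul h1)).mul h2⟩, by
    intro w hw
    have h1 : AnalyticAt ℂ (ext1 h.log.1) w := h.log.2 w hw
    have h2 : AnalyticAt ℂ (ext1 (pull1 h.mat f).1) w := (pull1 h.mat f).2 w hw
    exact ((analyticAt_const.mul h1).cexp).mul h2⟩
  map_add' f g := by
    ext z
    exact mul_add _ _ _
  map_smul' c f := by
    ext z
    exact mul_left_comm _ _ _

/-- `f(z₁, z₂) ↦ (c z₁ + d) ^ (-lam₁) (c z₂ + d) ^ (-lam₂) f(h z₁, h z₂)`. -/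
def slash2 (lam₁ lam₂ : ℂ) (h : SL2Cover) : Hol2 →ₗ[ℂ] Hol2 where
  toFun f := ⟨⟨fun z => Complex.exp (-lam₁ * h.log.1 z.1) * Complex.exp (-lam₂ * h.log.1 z.2) *
      f.1 (h.mat • z.1, h.mat • z.2), by
    have h1 := h.log.1.continuous
    have h2 := continuous_moebius h.mat
    have h3 : Continuous fun z : ℍ × ℍ => f.1 (h.mat • z.1, h.mat • z.2) :=
      f.1.continuous.comp
        ((h2.comp continuous_fst).prodMk (h2.comp continuous_snd))
    exact ((Complex.continuous_exp.comp (continuous_const.mul (h1.comp continuous_fst))).mul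
      (Complex.continuous_exp.comp (continuous_const.mul (h1.comp continuous_snd)))).mul h3⟩, by
    intro w hw
    have e1 : AnalyticAt ℂ (fun v : ℂ × ℂ => ext1 h.log.1 v.1) w :=
      AnalyticAt.fun_comp (h.log.2 w.1 hw.1) analyticAt_fst
    have e2 : AnalyticAt ℂ (fun v : ℂ × ℂ => ext1 h.log.1 v.2) w :=
      AnalyticAt.fun_comp (h.log.2 w.2 hw.2) analyticAt_snd
    have m1 : AnalyticAt ℂ (fun v : ℂ × ℂ => ((h.mat • (ofComplex v.1) : ℍ) : ℂ)) w :=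
      AnalyticAt.fun_comp (g := fun v : ℂ => ((h.mat • (ofComplex v) : ℍ) : ℂ))
        (analyticAt_moebius h.mat hw.1) analyticAt_fst
    have m2 : AnalyticAt ℂ (fun v : ℂ × ℂ => ((h.mat • (ofComplex v.2) : ℍ) : ℂ)) w :=
      AnalyticAt.fun_comp (g := fun v : ℂ => ((h.mat • (ofComplex v) : ℍ) : ℂ))
        (analyticAt_moebius h.mat hw.2) analyticAt_snd
    have h3 : AnalyticAt ℂ (ext2 f.1) (((h.mat • (ofComplex w.1) : ℍ) : ℂ),
        ((h.mat • (ofComplex w.2) : ℍ) : ℂ)) := f.2 _ (coe_mem_U2 (_, _))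
    have h4 := AnalyticAt.fun_comp (f := fun v : ℂ × ℂ => (((h.mat • (ofComplex v.1) : ℍ) : ℂ),
        ((h.mat • (ofComplex v.2) : ℍ) : ℂ))) h3 (m1.prod m2)
    refine ((((analyticAt_const (v := -lam₁)).mul e1).cexp.mul
      ((analyticAt_const (v := -lam₂)).mul e2).cexp).mul h4).congr
      (Filter.Eventually.of_forall fun v => ?_)
    simp [ext1, ext2]⟩
  map_add' f g := by
    ext z
    exact mul_add _ _ _
  map_smul' c f := by
    ext z
    exact mul_left_comm _ _ _

/-- The representation `π_lam` on `𝒪(H₊)`: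
`(π_lam(g) f)(z) = (c z + d) ^ (-lam) f((a z + b) / (c z + d))` where `a, b, c, d` are the entries
of `g⁻¹`. -/
def pi1 (lam : ℂ) : Representation ℂ SL2Cover Hol1 where
  toFun g := slash1 lam g⁻¹
  map_one' := by
    ext f z
    change Complex.exp (-lam * (1⁻¹ : SL2Cover).log.1 z) * f.1 ((1⁻¹ : SL2Cover).mat • z) = f.1 z
    simp [SL2Cover.one_log, SL2Cover.one_mat]
  map_mul' g h := by
    ext f z
    change Complex.exp (-lam * ((g * h)⁻¹ : SL2Cover).log.1 z) *
        f.1 (((g * h)⁻¹ : SL2Cover).mat • z) =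
      Complex.exp (-lam * (g⁻¹ : SL2Cover).log.1 z) *
        (Complex.exp (-lam * (h⁻¹ : SL2Cover).log.1 ((g⁻¹ : SL2Cover).mat • z)) *
          f.1 ((h⁻¹ : SL2Cover).mat • (g⁻¹ : SL2Cover).mat • z))
    rw [mul_inv_rev, SL2Cover.mul_log, SL2Cover.mul_mat, mul_smul, mul_add, Complex.exp_add]
    ring

/-- The representation `π_lam₁ ⊗ π_lam₂` on `𝒪(H₊ × H₊)`, restricted to the diagonal. -/
def pi2 (lam₁ lam₂ : ℂ) : Representation ℂ SL2Cover Hol2 where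
  toFun g := slash2 lam₁ lam₂ g⁻¹
  map_one' := by
    ext f z
    change Complex.exp (-lam₁ * (1⁻¹ : SL2Cover).log.1 z.1) *
      Complex.exp (-lam₂ * (1⁻¹ : SL2Cover).log.1 z.2) *
      f.1 ((1⁻¹ : SL2Cover).mat • z.1, (1⁻¹ : SL2Cover).mat • z.2) = f.1 z
    simp [SL2Cover.one_log, SL2Cover.one_mat]
  map_mul' g h := by
    ext f z
    change Complex.exp (-lam₁ * ((g * h)⁻¹ : SL2Cover).log.1 z.1) *
        Complex.exp (-lam₂ * ((g * h)⁻¹ : SL2Cover).log.1 z.2) *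
        f.1 (((g * h)⁻¹ : SL2Cover).mat • z.1, ((g * h)⁻¹ : SL2Cover).mat • z.2) =
      Complex.exp (-lam₁ * (g⁻¹ : SL2Cover).log.1 z.1) *
        Complex.exp (-lam₂ * (g⁻¹ : SL2Cover).log.1 z.2) *
        (Complex.exp (-lam₁ * (h⁻¹ : SL2Cover).log.1 ((g⁻¹ : SL2Cover).mat • z.1)) *
          Complex.exp (-lam₂ * (h⁻¹ : SL2Cover).log.1 ((g⁻¹ : SL2Cover).mat • z.2)) *
          f.1 ((h⁻¹ : SL2Cover).mat • (g⁻¹ : SL2Cover).mat • z.1,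
            (h⁻¹ : SL2Cover).mat • (g⁻¹ : SL2Cover).mat • z.2))
    simp only [mul_inv_rev, SL2Cover.mul_log, SL2Cover.mul_mat, mul_smul, mul_add,
      Complex.exp_add]
    ring

theorem continuous_add_hol1 {S T : Hol2 →ₗ[ℂ] Hol1} (hS : Continuous S) (hT : Continuous T) :
    Continuous fun f => S f + T f :=
  Continuous.subtype_mk ((continuous_subtype_val.comp hS).add (continuous_subtype_val.comp hT)) _

theorem continuous_smul_hol1 (c : ℂ) {T : Hol2 →ₗ[ℂ] Hol1} (hT : Continuous T) :
    Continuous fun f => c • T f :=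
  Continuous.subtype_mk ((continuous_subtype_val.comp hT).const_smul c) _

/-- `H(lam₁, lam₂, lam₃)`: the space of continuous linear maps `T : 𝒪(H₊ × H₊) → 𝒪(H₊)` that
intertwine `π_lam₁ ⊗ π_lam₂` and `π_lam₃`. -/
def intertwiners (lam₁ lam₂ lam₃ : ℂ) : Submodule ℂ (Hol2 →ₗ[ℂ] Hol1) where
  carrier := {T | Continuous T ∧
    ∀ (g : SL2Cover) (f : Hol2), T (pi2 lam₁ lam₂ g f) = pi1 lam₃ g (T f)}
  zero_mem' := ⟨continuous_const, fun g f => by simp⟩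
  add_mem' := fun hS hT => ⟨continuous_add_hol1 hS.1 hT.1, fun g f => by
    simp only [LinearMap.add_apply, map_add, hS.2 g f, hT.2 g f]⟩
  smul_mem' := fun c _ hT => ⟨continuous_smul_hol1 c hT.1, fun g f => by
    simp only [LinearMap.smul_apply, map_smul, hT.2 g f]⟩

/-! ### Differential operators -/

theorem analyticOnNhd_dir (f : Hol2) (v : ℂ × ℂ) :
    AnalyticOnNhd ℂ (fun w => fderiv ℂ (ext2 f.1) w v) U2 := fun w hw =>
  ((ContinuousLinearMap.apply ℂ ℂ v).analyticAt _).fun_comp (f.2 w hw).fderiv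

/-- The derivative of `f(z₁, z₂)` in the direction `v`. -/
def dir (v : ℂ × ℂ) : Hol2 →ₗ[ℂ] Hol2 where
  toFun f := ⟨⟨fun z => fderiv ℂ (ext2 f.1) (z.1, z.2) v,
    (analyticOnNhd_dir f v).continuousOn.comp_continuous
      ((UpperHalfPlane.continuous_coe.comp continuous_fst).prodMk
        (UpperHalfPlane.continuous_coe.comp continuous_snd)) coe_mem_U2⟩, by
    intro w hw
    refine (analyticOnNhd_dir f v w hw).congr ?_
    filter_upwards [isOpen_U2.mem_nhds hw] with u hu
    simp only [ext2, ContinuousMap.coe_mk]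
    rw [coe_ofComplex hu.1, coe_ofComplex hu.2]⟩
  map_add' f g := by
    ext z
    have hf := (f.2 _ (coe_mem_U2 z)).differentiableAt
    have hg := (g.2 _ (coe_mem_U2 z)).differentiableAt
    have h : fderiv ℂ (ext2 f.1 + ext2 g.1) (z.1, z.2) =
      fderiv ℂ (ext2 f.1) (z.1, z.2) + fderiv ℂ (ext2 g.1) (z.1, z.2) := fderiv_add hf hg
    exact DFunLike.congr_fun h v
  map_smul' c f := by
    ext z
    have hf := (f.2 _ (coe_mem_U2 z)).differentiableAt
    have h : fderiv ℂ (c • ext2 f.1) (z.1, z.2) = c • fderiv ℂ (ext2 f.1) (z.1, z.2) :=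
      fderiv_const_smul hf c
    exact DFunLike.congr_fun h v

/-- `∂/∂z₁` on `𝒪(H₊ × H₊)`. -/
def d1 : Hol2 →ₗ[ℂ] Hol2 := dir (1, 0)

/-- `∂/∂z₂` on `𝒪(H₊ × H₊)`. -/
def d2 : Hol2 →ₗ[ℂ] Hol2 := dir (0, 1)

/-- Restriction to the diagonal: `f(z₁, z₂) ↦ f(z, z)`. -/
def diag : Hol2 →ₗ[ℂ] Hol1 where
  toFun f := ⟨⟨fun z => f.1 (z, z), f.1.continuous.comp (continuous_id.prodMk continuous_id)⟩, by
    intro w hw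
    have h : AnalyticAt ℂ (ext2 f.1) (w, w) := f.2 (w, w) ⟨hw, hw⟩
    exact AnalyticAt.fun_comp (f := fun v : ℂ => (v, v)) h (analyticAt_id.prod analyticAt_id)⟩
  map_add' _ _ := rfl
  map_smul' _ _ := rfl

/-- `T : 𝒪(H₊ × H₊) → 𝒪(H₊)` is a holomorphic differential operator along the diagonal embedding:
`(T f)(z) = ∑_{i, j < N} c i j z * (∂₁^i ∂₂^j f)(z, z)` with holomorphic coefficients. -/
def IsDifferential (T : Hol2 →ₗ[ℂ] Hol1) : Prop :=
  ∃ (N : ℕ) (c : ℕ → ℕ → Hol1), ∀ (f : Hol2) (z : ℍ),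
    (T f).1 z = ∑ i ∈ Finset.range N, ∑ j ∈ Finset.range N,
      (c i j).1 z * (diag ((d1 ^ i) ((d2 ^ j) f))).1 z

/-- The coefficient
`(-1)^l / (l! (a-l)!) * Γ(lam₁+a) Γ(lam₂+a) / (Γ(lam₁+a-l) Γ(lam₂+l))`, `0 ≤ l ≤ a`,
continued holomorphically to all `lam₁, lam₂`: the two quotients of Gamma functions are the
polynomials `(lam₁+a-l)_l` and `(lam₂+l)_{a-l}` in Pochhammer's notation. -/
def coeff (lam₁ lam₂ : ℂ) (a l : ℕ) : ℂ :=
  (-1) ^ l / ((l.factorial : ℂ) * ((a - l).factorial : ℂ)) *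
    ((ascPochhammer ℂ l).eval (lam₁ + a - l) * (ascPochhammer ℂ (a - l)).eval (lam₂ + l))

/-- Where the Gamma functions have no poles, `coeff` is the expression with Gamma functions. -/
theorem coeff_eq_Gamma (lam₁ lam₂ : ℂ) {a l : ℕ} (hl : l ≤ a)
    (h₁ : ∀ k : ℕ, lam₁ + a - l ≠ -k) (h₂ : ∀ k : ℕ, lam₂ + l ≠ -k) :
    coeff lam₁ lam₂ a l = (-1) ^ l / ((l.factorial : ℂ) * ((a - l).factorial : ℂ)) *
      (Complex.Gamma (lam₁ + a) * Complex.Gamma (lam₂ + a) /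
        (Complex.Gamma (lam₁ + a - l) * Complex.Gamma (lam₂ + l))) := by
  rw [coeff, ← Complex.Gamma_add_nat_div_Gamma_eq _ h₁, ← Complex.Gamma_add_nat_div_Gamma_eq _ h₂,
    Nat.cast_sub hl, sub_add_cancel, add_add_sub_cancel, div_mul_div_comm]

/-- The holomorphically continued Rankin–Cohen operator `RC_{lam₁, lam₂}^{lam₁ + lam₂ + 2a}`:
`f ↦ (z ↦ ∑_{l=0}^a coeff lam₁ lam₂ a l * (∂₁^(a-l) ∂₂^l f)(z, z))`. -/
def RC (lam₁ lam₂ : ℂ) (a : ℕ) : Hol2 →ₗ[ℂ] Hol1 :=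
  ∑ l ∈ Finset.range (a + 1), coeff lam₁ lam₂ a l • (diag ∘ₗ (d1 ^ (a - l) * d2 ^ l))

/-! ### Parameter sets -/

/-- `Ω`: the triples with `lam₃ - lam₁ - lam₂ ∈ {0, 2, 4, …}`. -/
def Omega : Set (ℂ × ℂ × ℂ) :=
  {p | ∃ a : ℕ, p.2.2 - p.1 - p.2.1 = 2 * (a : ℂ)}

/-- `Ω_sing`: the integral triples in `Ω` with
`lam₃ - |lam₁ - lam₂| ≥ 2 ≥ lam₁ + lam₂ + lam₃`. -/
def OmegaSing : Set (ℂ × ℂ × ℂ) :=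
  {p | p ∈ Omega ∧ ∃ l₁ l₂ l₃ : ℤ, p = ((l₁ : ℂ), (l₂ : ℂ), (l₃ : ℂ)) ∧
    l₃ - |l₁ - l₂| ≥ 2 ∧ 2 ≥ l₁ + l₂ + l₃}

end RankinCohen

end

open RankinCohen

/-!
Write `a = (λ₃ - λ₁ - λ₂) / 2`. The proof reduces the classification of intertwining operators to
a two-term linear recurrence.

*Intertwining operators are differential operators.* Polynomials are dense in `𝒪(H₊ × H₊)`: a
compact subset of the upper half plane lies in a disc inside it, and Taylor expansion in one
variable at a time converges uniformly there (`mem_of_isClosed_of_mono1`). So a continuous `T` is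
determined at `z` by its values on the monomials `(z₁ - z)^m (z₂ - z)^n`, for which it suffices to
know `G = T(z₁^m z₂^n)` and its analogues centred elsewhere. Equivariance under translations forces
`G` to be the restriction of an entire function `p`, with `T((z₁ - w)^m (z₂ - w)^n)(z) = p(z - w)`,
and equivariance under dilations forces `p` to be homogeneous of degree `m + n - a`. Hence the
value at `w = z` is the constant `p(0)`, which vanishes unless `m + n = a`
(`exists_values_of_mem_intertwiners`). Therefore `T = 0` if `a` is not a natural number, and
otherwise `T` is a combination `bidiff a b` of the operators `f ↦ (∂₁^(a-l) ∂₂^l f)(z, z)` with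
constant coefficients `b_l / ((a - l)! l!)`.

*The recurrence.* For `h` in the covering group, in coordinates centred at `z` and at `h z`, the
group acts on monomials by multiplication with automorphy factors (`slash1_mono1`), whose
derivatives are explicit. Comparing the two sides of the intertwining relation on the monomials of
degree `a - 1` gives `(λ₁ + a - 1 - n) b_n + (λ₂ + n) b_{n+1} = 0` for `n < a`
(`recurrence_of_mem_intertwiners`). Conversely the recurrence makes all contributions of lower
degree vanish, because each is a multiple of `∑ (-1)^j (k choose j) = 0`
(`Recurrence.sum_eq_zero`), so that `bidiff a b` is an intertwining operator.

*Solving it.* The Rankin–Cohen coefficients `rcSeq` solve the recurrence. If they do not all vanish,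
they span its solutions (`intertwiners_eq_span_RC`). They all vanish exactly when
`λ₁ = j + 1 - a` and `λ₂ = -i` with `0 ≤ j ≤ i < a`, which is the condition defining `OmegaSing`.
The recurrence then decouples, and its solutions are spanned by one sequence supported on `l ≤ j`
and one supported on `l > i`; these are the coefficients of the two compositions of a Rankin–Cohen
operator with a power of a partial derivative (`intertwiners_eq_span_pair`).
-/

open UpperHalfPlane
open scoped MatrixGroups

noncomputable section

namespace RankinCohen

/-! ### One-variable calculus and products of one-variable functions -/

theorem ext1_coe (f : ℍ → ℂ) (z : ℍ) : ext1 f z = f z := by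
  simp [ext1]

theorem ext2_coe (f : ℍ × ℍ → ℂ) (z : ℍ × ℍ) : ext2 f ((z.1 : ℂ), (z.2 : ℂ)) = f z := by
  simp [ext2]

theorem hol1_ext {f g : Hol1} (h : ∀ z, f.1 z = g.1 z) : f = g :=
  Subtype.ext (ContinuousMap.ext h)

theorem hol2_ext {f g : Hol2} (h : ∀ z, f.1 z = g.1 z) : f = g :=
  Subtype.ext (ContinuousMap.ext h)

/-- The restriction to the upper half plane of a function that is analytic there. -/
def ofAnalytic (F : ℂ → ℂ) (hF : AnalyticOnNhd ℂ F U1) : Hol1 :=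
  ⟨⟨fun z => F z, hF.continuousOn.comp_continuous UpperHalfPlane.continuous_coe coe_mem_U1⟩, by
    intro w hw
    refine (hF w hw).congr ?_
    filter_upwards [isOpen_U1.mem_nhds hw] with u hu
    simp only [ext1, ContinuousMap.coe_mk, coe_ofComplex hu]⟩

@[simp] theorem ofAnalytic_apply (F : ℂ → ℂ) (hF : AnalyticOnNhd ℂ F U1) (z : ℍ) :
    (ofAnalytic F hF).1 z = F z := rfl

/-- The derivative `d/dz` on `𝒪(H₊)`. -/
def der (f : Hol1) : Hol1 := ofAnalytic (deriv (ext1 f.1)) f.2.deriv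

theorem hasDerivAt_ext1 (f : Hol1) (z : ℍ) : HasDerivAt (ext1 f.1) ((der f).1 z) z :=
  (f.2 _ (coe_mem_U1 z)).differentiableAt.hasDerivAt

theorem der_eq_of_hasDerivAt {f : Hol1} {F : ℂ → ℂ} {z : ℍ} {c : ℂ}
    (hF : ∀ w : ℍ, f.1 w = F w) (h : HasDerivAt F c z) : (der f).1 z = c := by
  refine (hasDerivAt_ext1 f z).unique (h.congr_of_eventuallyEq ?_)
  filter_upwards [isOpen_U1.mem_nhds (coe_mem_U1 z)] with u hu
  rw [ext1, hF, coe_ofComplex hu]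

theorem der_add (f g : Hol1) : der (f + g) = der f + der g :=
  hol1_ext fun z => ((hasDerivAt_ext1 (f + g) z).unique
    ((hasDerivAt_ext1 f z).add (hasDerivAt_ext1 g z)))

theorem der_smul (c : ℂ) (f : Hol1) : der (c • f) = c • der f :=
  hol1_ext fun z => ((hasDerivAt_ext1 (c • f) z).unique ((hasDerivAt_ext1 f z).const_smul c))

theorem der_iterate_add (k : ℕ) (f g : Hol1) : der^[k] (f + g) = der^[k] f + der^[k] g := by
  induction k generalizing f g with
  | zero => rfl
  | succ k ih => simp only [Function.iterate_succ_apply, der_add, ih]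

theorem der_iterate_smul (k : ℕ) (c : ℂ) (f : Hol1) : der^[k] (c • f) = c • der^[k] f := by
  induction k generalizing f with
  | zero => rfl
  | succ k ih => simp only [Function.iterate_succ_apply, der_smul, ih]

/-- The pointwise product on `𝒪(H₊)`. -/
def mul1 (f g : Hol1) : Hol1 := ⟨f.1 * g.1, fun w hw => (f.2 w hw).mul (g.2 w hw)⟩

@[simp] theorem mul1_apply (f g : Hol1) (z : ℍ) : (mul1 f g).1 z = f.1 z * g.1 z := rfl

theorem der_mul1 (f g : Hol1) : der (mul1 f g) = mul1 (der f) g + mul1 f (der g) := by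
  refine hol1_ext fun z => (hasDerivAt_ext1 (mul1 f g) z).unique ?_
  have h := (hasDerivAt_ext1 f z).mul (hasDerivAt_ext1 g z)
  rw [ext1_coe, ext1_coe] at h
  exact h

/-- The function `z ↦ (z - w) ^ m` on the upper half plane. -/
def mono1 (w : ℂ) (m : ℕ) : Hol1 :=
  ofAnalytic (fun z => (z - w) ^ m) fun _ _ => (analyticAt_id.sub analyticAt_const).pow m

@[simp] theorem mono1_apply (w : ℂ) (m : ℕ) (z : ℍ) : (mono1 w m).1 z = ((z : ℂ) - w) ^ m := rfl

theorem der_mono1 (w : ℂ) (m : ℕ) : der (mono1 w m) = (m : ℂ) • mono1 w (m - 1) := by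
  refine hol1_ext fun z => der_eq_of_hasDerivAt (F := fun z => (z - w) ^ m) (fun _ => rfl) ?_
  have h := ((hasDerivAt_id (z : ℂ)).sub_const w).pow m
  exact h.congr_deriv (by change _ = (m : ℂ) * ((z : ℂ) - w) ^ (m - 1); simp)

/-- The Leibniz rule at the centre of a monomial. For `k < m` the falling factorial vanishes, so
the truncated exponent `k - m` is harmless. -/
theorem der_iterate_mono1_mul1 (z : ℍ) (k m : ℕ) (g : Hol1) :
    (der^[k] (mul1 (mono1 z m) g)).1 z = (k.descFactorial m : ℂ) * (der^[k - m] g).1 z := by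
  induction k generalizing m g with
  | zero =>
    cases m with
    | zero => simp
    | succ m => simp
  | succ k ih =>
    cases m with
    | zero =>
      have : mul1 (mono1 z 0) g = g := hol1_ext fun w => by simp
      simp [this]
    | succ m =>
      rw [Function.iterate_succ_apply, der_mul1, der_mono1, der_iterate_add]
      have h1 : mul1 (((m + 1 : ℕ) : ℂ) • mono1 z (m + 1 - 1)) g =
          ((m + 1 : ℕ) : ℂ) • mul1 (mono1 z m) g := hol1_ext fun w => mul_assoc _ _ _
      have h2 (u v : Hol1) : (u + v).1 z = u.1 z + v.1 z := rfl
      have h3 (c : ℂ) (u : Hol1) : (c • u).1 z = c * u.1 z := rfl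
      rw [h1, der_iterate_smul, h2, h3, ih, ih, Nat.add_sub_add_right]
      rcases lt_or_ge m k with hmk | hmk
      · rw [← Function.iterate_succ_apply, show (k - (m + 1)).succ = k - m by omega,
          Nat.succ_descFactorial_succ, Nat.descFactorial_succ]
        obtain ⟨d, rfl⟩ := Nat.exists_eq_add_of_lt hmk
        rw [show m + d + 1 - m = d + 1 by omega]
        push_cast
        ring
      · rw [Nat.descFactorial_of_lt (show k < m + 1 by omega), Nat.succ_descFactorial_succ]
        rcases hmk.eq_or_lt with rfl | h
        · push_cast; ring
        · rw [Nat.descFactorial_of_lt h]; simp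

theorem der_iterate_mono1 (z : ℍ) (k m : ℕ) :
    (der^[k] (mono1 z m)).1 z = if k = m then (m.factorial : ℂ) else 0 := by
  have h := der_iterate_mono1_mul1 z k m (mono1 z 0)
  have e : mul1 (mono1 z m) (mono1 z 0) = mono1 z m := hol1_ext fun w => by simp
  rw [e] at h
  rw [h]
  rcases lt_trichotomy k m with hk | rfl | hk
  · rw [Nat.descFactorial_of_lt hk, if_neg hk.ne]; simp
  · simp [Nat.descFactorial_self]
  · rw [if_neg hk.ne']
    obtain ⟨d, hd⟩ : ∃ d, k - m = d + 1 := ⟨k - m - 1, by omega⟩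
    rw [hd, Function.iterate_succ_apply, der_mono1, der_iterate_smul]
    have h3 (c : ℂ) (u : Hol1) : (c • u).1 z = c * u.1 z := rfl
    rw [h3]; simp

/-- The automorphy factor `(c z + d) ^ (-μ)` attached to an element of the covering group. -/
def autom (μ : ℂ) (h : SL2Cover) : Hol1 :=
  ⟨⟨fun z => Complex.exp (-μ * h.log.1 z),
    Complex.continuous_exp.comp (continuous_const.mul h.log.1.continuous)⟩, fun w hw =>
      (analyticAt_const.mul (h.log.2 w hw : AnalyticAt ℂ (ext1 h.log.1) w)).cexp⟩

@[simp] theorem autom_apply (μ : ℂ) (h : SL2Cover) (z : ℍ) :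
    (autom μ h).1 z = Complex.exp (-μ * h.log.1 z) := rfl

/-- The branch `φ` of `log (c z + d)` satisfies `φ' = c / (c z + d)`. -/
theorem der_log (h : SL2Cover) (z : ℍ) :
    (der h.log).1 z = ((h.mat 1 0 : ℝ) : ℂ) * Complex.exp (-h.log.1 z) := by
  have h1 := (hasDerivAt_ext1 h.log z).cexp
  have h2 : HasDerivAt (fun w : ℂ => ((h.mat 1 0 : ℝ) : ℂ) * w + ((h.mat 1 1 : ℝ) : ℂ))
      ((h.mat 1 0 : ℝ) : ℂ) z := by
    simpa using ((hasDerivAt_id (z : ℂ)).const_mul ((h.mat 1 0 : ℝ) : ℂ)).add_const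
      ((h.mat 1 1 : ℝ) : ℂ)
  have h3 := h1.unique (h2.congr_of_eventuallyEq (by
    filter_upwards [isOpen_U1.mem_nhds (coe_mem_U1 z)] with u hu
    simp only [ext1]
    rw [h.exp_log, coe_ofComplex hu]))
  rw [ext1_coe] at h3
  rw [← h3, Complex.exp_neg]
  field_simp

theorem der_autom (μ : ℂ) (h : SL2Cover) :
    der (autom μ h) = (-((h.mat 1 0 : ℝ) : ℂ) * μ) • autom (μ + 1) h := by
  refine hol1_ext fun z => (hasDerivAt_ext1 (autom μ h) z).unique ?_
  have h1 := ((hasDerivAt_ext1 h.log z).const_mul (-μ)).cexp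
  rw [ext1_coe, der_log] at h1
  refine h1.congr_deriv ?_
  change _ = (-((h.mat 1 0 : ℝ) : ℂ) * μ) * Complex.exp (-(μ + 1) * h.log.1 z)
  rw [show -(μ + 1) * h.log.1 z = -μ * h.log.1 z + -h.log.1 z by ring, Complex.exp_add]
  ring

theorem der_iterate_autom (k : ℕ) (μ : ℂ) (h : SL2Cover) :
    der^[k] (autom μ h) = ((-((h.mat 1 0 : ℝ) : ℂ)) ^ k * (ascPochhammer ℂ k).eval μ) •
      autom (μ + k) h := by
  induction k generalizing μ with
  | zero => simp
  | succ k ih =>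
    rw [Function.iterate_succ_apply, der_autom, der_iterate_smul, ih, smul_smul,
      ascPochhammer_succ_left, Polynomial.eval_mul, Polynomial.eval_comp]
    simp only [Polynomial.eval_X, Polynomial.eval_add, Polynomial.eval_one, Nat.cast_add,
      Nat.cast_one]
    rw [show μ + 1 + (k : ℂ) = μ + (k + 1) by ring]
    congr 1
    ring

theorem slash1_apply (lam : ℂ) (h : SL2Cover) (f : Hol1) (z : ℍ) :
    (slash1 lam h f).1 z = Complex.exp (-lam * h.log.1 z) * f.1 (h.mat • z) := rfl

theorem slash2_apply (lam₁ lam₂ : ℂ) (h : SL2Cover) (f : Hol2) (z : ℍ × ℍ) :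
    (slash2 lam₁ lam₂ h f).1 z = Complex.exp (-lam₁ * h.log.1 z.1) *
      Complex.exp (-lam₂ * h.log.1 z.2) * f.1 (h.mat • z.1, h.mat • z.2) := rfl

theorem moebius_sub (h : SL2Cover) (z z₀ : ℍ) :
    ((h.mat • z : ℍ) : ℂ) - ((h.mat • z₀ : ℍ) : ℂ) =
      ((z : ℂ) - z₀) * (Complex.exp (-h.log.1 z) * Complex.exp (-h.log.1 z₀)) := by
  have h0 (z : ℍ) : ((h.mat 1 0 : ℝ) : ℂ) * z + (h.mat 1 1 : ℝ) ≠ 0 :=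
    denom_ne_zero (Matrix.SpecialLinearGroup.mapGL ℝ h.mat) z
  have hdet : ((h.mat 0 0 : ℝ) : ℂ) * (h.mat 1 1 : ℝ) - (h.mat 0 1 : ℝ) * (h.mat 1 0 : ℝ) = 1 := by
    have := h.mat.det_coe
    rw [Matrix.det_fin_two] at this
    exact_mod_cast this
  rw [Complex.exp_neg, Complex.exp_neg, h.exp_log, h.exp_log, coe_specialLinearGroup_apply,
    coe_specialLinearGroup_apply]
  simp only [Algebra.algebraMap_self, RingHom.id_apply]
  have h1 := h0 z
  have h2 := h0 z₀
  rw [div_sub_div _ _ h1 h2, ← mul_inv, ← div_eq_mul_inv]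
  congr 1
  linear_combination ((z : ℂ) - z₀) * hdet

/-- In the coordinates centred at `z₀` and at its image, the action on monomials is
multiplication by an automorphy factor. -/
theorem slash1_mono1 (lam : ℂ) (h : SL2Cover) (z₀ : ℍ) (m : ℕ) :
    slash1 lam h (mono1 ((h.mat • z₀ : ℍ) : ℂ) m) =
      Complex.exp (-(m : ℂ) * h.log.1 z₀) • mul1 (mono1 z₀ m) (autom (lam + m) h) := by
  refine hol1_ext fun z => ?_
  change Complex.exp (-lam * h.log.1 z) * (((h.mat • z : ℍ) : ℂ) - ((h.mat • z₀ : ℍ) : ℂ)) ^ m =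
    Complex.exp (-(m : ℂ) * h.log.1 z₀) *
      (((z : ℂ) - z₀) ^ m * Complex.exp (-(lam + m) * h.log.1 z))
  rw [moebius_sub, mul_pow, mul_pow, ← Complex.exp_nat_mul, ← Complex.exp_nat_mul,
    show -(lam + m) * h.log.1 z = -lam * h.log.1 z + m * -h.log.1 z by ring, Complex.exp_add,
    show -(m : ℂ) * h.log.1 z₀ = m * -h.log.1 z₀ by ring]
  ring

/-- The function `(z₁, z₂) ↦ f(z₁) g(z₂)`. -/
def tens (f g : Hol1) : Hol2 :=
  ⟨⟨fun z => f.1 z.1 * g.1 z.2, (f.1.continuous.comp continuous_fst).mul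
      (g.1.continuous.comp continuous_snd)⟩, fun w hw =>
    (AnalyticAt.fun_comp (f := Prod.fst) (f.2 w.1 hw.1) analyticAt_fst).mul
      (AnalyticAt.fun_comp (f := Prod.snd) (g.2 w.2 hw.2) analyticAt_snd)⟩

@[simp] theorem tens_apply (f g : Hol1) (z : ℍ × ℍ) : (tens f g).1 z = f.1 z.1 * g.1 z.2 := rfl

theorem slash2_tens (lam₁ lam₂ : ℂ) (h : SL2Cover) (f g : Hol1) :
    slash2 lam₁ lam₂ h (tens f g) = tens (slash1 lam₁ h f) (slash1 lam₂ h g) := by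
  refine hol2_ext fun z => ?_
  simp only [slash2_apply, slash1_apply, tens_apply]
  ring

theorem dir_apply (v : ℂ × ℂ) (f : Hol2) (z : ℍ × ℍ) :
    (dir v f).1 z = fderiv ℂ (ext2 f.1) (z.1, z.2) v := rfl

theorem hasFDerivAt_tens (f g : Hol1) (z : ℍ × ℍ) :
    HasFDerivAt (ext2 (tens f g).1)
      (f.1 z.1 • ((ContinuousLinearMap.toSpanSingleton ℂ ((der g).1 z.2)).comp
          (ContinuousLinearMap.snd ℂ ℂ ℂ)) +
        g.1 z.2 • ((ContinuousLinearMap.toSpanSingleton ℂ ((der f).1 z.1)).comp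
          (ContinuousLinearMap.fst ℂ ℂ ℂ))) ((z.1 : ℂ), (z.2 : ℂ)) := by
  have h1 : HasFDerivAt (fun w : ℂ × ℂ => ext1 f.1 w.1) _ ((z.1 : ℂ), (z.2 : ℂ)) :=
    HasFDerivAt.comp (g := ext1 f.1) ((z.1 : ℂ), (z.2 : ℂ))
      (hasDerivAt_ext1 f z.1).hasFDerivAt hasFDerivAt_fst
  have h2 : HasFDerivAt (fun w : ℂ × ℂ => ext1 g.1 w.2) _ ((z.1 : ℂ), (z.2 : ℂ)) :=
    HasFDerivAt.comp (g := ext1 g.1) ((z.1 : ℂ), (z.2 : ℂ))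
      (hasDerivAt_ext1 g z.2).hasFDerivAt hasFDerivAt_snd
  have h := h1.mul h2
  simp only [ext1_coe] at h
  exact h

theorem d1_tens (f g : Hol1) : d1 (tens f g) = tens (der f) g := by
  refine hol2_ext fun z => ?_
  rw [d1, dir_apply, (hasFDerivAt_tens f g z).fderiv]
  simp [mul_comm]

theorem d2_tens (f g : Hol1) : d2 (tens f g) = tens f (der g) := by
  refine hol2_ext fun z => ?_
  rw [d2, dir_apply, (hasFDerivAt_tens f g z).fderiv]
  simp

theorem d1_pow_tens (m : ℕ) (f g : Hol1) : (d1 ^ m) (tens f g) = tens (der^[m] f) g := by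
  induction m generalizing f with
  | zero => rfl
  | succ m ih => rw [pow_succ, Module.End.mul_apply, d1_tens, ih, Function.iterate_succ_apply]

theorem d2_pow_tens (m : ℕ) (f g : Hol1) : (d2 ^ m) (tens f g) = tens f (der^[m] g) := by
  induction m generalizing g with
  | zero => rfl
  | succ m ih => rw [pow_succ, Module.End.mul_apply, d2_tens, ih, Function.iterate_succ_apply]

/-- The operator `f ↦ (z ↦ (∂₁^m ∂₂^n f)(z, z))`. -/
def jet (m n : ℕ) : Hol2 →ₗ[ℂ] Hol1 := diag ∘ₗ (d1 ^ m * d2 ^ n)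

theorem jet_apply (m n : ℕ) (f : Hol2) : jet m n f = diag ((d1 ^ m) ((d2 ^ n) f)) := rfl

theorem jet_tens (m n : ℕ) (f g : Hol1) (z : ℍ) :
    (jet m n (tens f g)).1 z = (der^[m] f).1 z * (der^[n] g).1 z := by
  rw [jet_apply, d2_pow_tens, d1_pow_tens]
  rfl

/-! ### Continuity of the basic operators -/

theorem continuousOn_ofComplex_U1 : ContinuousOn (fun w => (ofComplex w : ℍ)) U1 := by
  rw [UpperHalfPlane.isEmbedding_coe.continuousOn_iff]
  exact continuousOn_id.congr fun w hw => coe_ofComplex hw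

theorem continuousOn_ofComplex_U2 :
    ContinuousOn (fun w : ℂ × ℂ => ((ofComplex w.1, ofComplex w.2) : ℍ × ℍ)) U2 :=
  (continuousOn_ofComplex_U1.comp continuousOn_fst fun _ hw => hw.1).prodMk
    (continuousOn_ofComplex_U1.comp continuousOn_snd fun _ hw => hw.2)

theorem continuous_coe2 : Continuous fun z : ℍ × ℍ => ((z.1 : ℂ), (z.2 : ℂ)) :=
  (UpperHalfPlane.continuous_coe.comp continuous_fst).prodMk
    (UpperHalfPlane.continuous_coe.comp continuous_snd)

theorem hol2_eventually (f : Hol2) {K : Set (ℍ × ℍ)} (hK : IsCompact K) {ε : ℝ} (hε : 0 < ε) :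
    ∀ᶠ g : Hol2 in nhds f, ∀ z ∈ K, ‖g.1 z - f.1 z‖ < ε := by
  have h : Filter.Tendsto (fun g : Hol2 => g.1) (nhds f) (nhds f.1) :=
    continuous_subtype_val.continuousAt
  have h1 := Metric.tendstoUniformlyOn_iff.1
    (ContinuousMap.tendsto_iff_forall_isCompact_tendstoUniformlyOn.1 h K hK) ε hε
  filter_upwards [h1] with g hg z hz
  rw [← dist_eq_norm, dist_comm]
  exact hg z hz

theorem continuous_hol2_of_eventually {T : Hol2 → Hol2}
    (h : ∀ (f : Hol2) (K : Set (ℍ × ℍ)), IsCompact K → ∀ ε > (0 : ℝ),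
      ∀ᶠ g : Hol2 in nhds f, ∀ z ∈ K, ‖(T g).1 z - (T f).1 z‖ < ε) : Continuous T := by
  refine continuous_induced_rng.2 (continuous_iff_continuousAt.2 fun f => ?_)
  refine ContinuousMap.tendsto_iff_forall_isCompact_tendstoUniformlyOn.2 fun K hK =>
    Metric.tendstoUniformlyOn_iff.2 fun ε hε => ?_
  filter_upwards [h f K hK ε hε] with g hg z hz
  rw [dist_comm, dist_eq_norm]
  exact hg z hz

/-- Around every point of a compact set there are complex discs of a common radius in a given
direction that stay in a larger compact subset. -/
theorem exists_compact_discs {K : Set (ℍ × ℍ)} (hK : IsCompact K) (v : ℂ × ℂ) :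
    ∃ δ > (0 : ℝ), ∃ K' : Set (ℍ × ℍ), IsCompact K' ∧ ∀ z ∈ K, ∀ t : ℂ, ‖t‖ ≤ δ →
      ((z.1 : ℂ), (z.2 : ℂ)) + t • v ∈ U2 ∧
        (ofComplex (((z.1 : ℂ), (z.2 : ℂ)) + t • v).1,
          ofComplex (((z.1 : ℂ), (z.2 : ℂ)) + t • v).2) ∈ K' := by
  obtain ⟨r, hr, hrU⟩ := (hK.image continuous_coe2).exists_cthickening_subset_open isOpen_U2
    (Set.image_subset_iff.2 fun z _ => coe_mem_U2 z)
  have hv : 0 < ‖v‖ + 1 := by positivity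
  refine ⟨r / (‖v‖ + 1), by positivity, _,
    ((hK.image continuous_coe2).cthickening (r := r)).image_of_continuousOn
      (continuousOn_ofComplex_U2.mono hrU), fun z hz t ht => ?_⟩
  have hmem : ((z.1 : ℂ), (z.2 : ℂ)) + t • v ∈
      Metric.cthickening r ((fun z : ℍ × ℍ => ((z.1 : ℂ), (z.2 : ℂ))) '' K) := by
    refine Metric.mem_cthickening_of_dist_le _ _ _ _ (Set.mem_image_of_mem _ hz) ?_
    rw [dist_eq_norm, add_sub_cancel_left, norm_smul]
    calc ‖t‖ * ‖v‖ ≤ r / (‖v‖ + 1) * (‖v‖ + 1) := by gcongr; linarith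
      _ = r := div_mul_cancel₀ _ hv.ne'
  exact ⟨hrU hmem, Set.mem_image_of_mem _ hmem⟩

/-- Continuity of the directional derivatives, by Cauchy's estimate on discs of a common radius. -/
theorem continuous_dir (v : ℂ × ℂ) : Continuous (dir v) := by
  refine continuous_hol2_of_eventually fun f K hK ε hε => ?_
  obtain ⟨δ, hδ, K', hK', hd⟩ := exists_compact_discs hK v
  filter_upwards [hol2_eventually f hK' (show 0 < ε / 2 * δ by positivity)] with g hg z hz
  have e : (dir v g).1 z - (dir v f).1 z = (dir v (g - f)).1 z :=
    (congrArg (fun F : Hol2 => F.1 z) ((dir v).map_sub g f)).symm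
  rw [e, dir_apply]
  set p : ℂ × ℂ := ((z.1 : ℂ), (z.2 : ℂ)) with hp
  have hana (t : ℂ) (ht : ‖t‖ ≤ δ) :
      DifferentiableAt ℂ (fun t : ℂ => ext2 (g - f).1 (p + t • v)) t :=
    DifferentiableAt.comp (g := ext2 (g - f).1) t
      ((g - f).2 _ (hd z hz t ht).1).differentiableAt (by fun_prop)
  have hderiv : deriv (fun t : ℂ => ext2 (g - f).1 (p + t • v)) 0 =
      fderiv ℂ (ext2 (g - f).1) p v := by
    have h1 : HasFDerivAt (ext2 (g - f).1) (fderiv ℂ (ext2 (g - f).1) p) (p + (0 : ℂ) • v) := by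
      rw [zero_smul, add_zero]
      exact ((g - f).2 p (coe_mem_U2 z)).differentiableAt.hasFDerivAt
    have h2 : HasDerivAt (fun t : ℂ => p + t • v) v 0 := by
      simpa using ((hasDerivAt_id (0 : ℂ)).smul_const v).const_add p
    exact (h1.comp_hasDerivAt (0 : ℂ) h2).deriv
  rw [← hderiv]
  refine lt_of_le_of_lt (Complex.norm_deriv_le_of_forall_mem_sphere_norm_le (C := ε / 2 * δ) hδ
    ?_ fun t ht => ?_) ?_
  · refine DifferentiableOn.diffContOnCl fun t ht => (hana t ?_).differentiableWithinAt
    simpa using Metric.closure_ball_subset_closedBall ht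
  · have ht' : ‖t‖ ≤ δ := by simpa using (mem_sphere_iff_norm.1 ht).le
    exact (hg _ (hd z hz t ht').2).le
  · rw [mul_div_cancel_right₀ _ hδ.ne']
    linarith

theorem continuous_dir_pow (v : ℂ × ℂ) (n : ℕ) : Continuous (dir v ^ n : Hol2 →ₗ[ℂ] Hol2) := by
  induction n with
  | zero => exact continuous_id
  | succ n ih =>
    rw [pow_succ]
    exact ih.comp (continuous_dir v)

theorem continuous_diag : Continuous diag :=
  continuous_induced_rng.2
    ((ContinuousMap.continuous_precomp ⟨fun z : ℍ => (z, z), by fun_prop⟩).comp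
      continuous_subtype_val)

theorem continuous_jet (m n : ℕ) : Continuous (jet m n) :=
  continuous_diag.comp ((continuous_dir_pow _ m).comp (continuous_dir_pow _ n))

theorem continuous_slash1 (lam : ℂ) (h : SL2Cover) : Continuous (slash1 lam h) :=
  continuous_induced_rng.2 (((ContinuousMap.continuous_precomp
    ⟨fun z : ℍ => h.mat • z, continuous_moebius h.mat⟩).comp continuous_subtype_val).const_mul
      (autom lam h).1)

theorem continuous_slash2 (lam₁ lam₂ : ℂ) (h : SL2Cover) : Continuous (slash2 lam₁ lam₂ h) :=
  continuous_induced_rng.2 (((ContinuousMap.continuous_precomp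
    ⟨fun z : ℍ × ℍ => (h.mat • z.1, h.mat • z.2),
      ((continuous_moebius h.mat).comp continuous_fst).prodMk
        ((continuous_moebius h.mat).comp continuous_snd)⟩).comp continuous_subtype_val).const_mul
      (tens (autom lam₁ h) (autom lam₂ h)).1)

theorem continuous_eval_hol1 (z : ℍ) : Continuous fun f : Hol1 => f.1 z :=
  (ContinuousEvalConst.continuous_eval_const z).comp continuous_subtype_val

/-! ### Density of polynomials -/

/-- Evaluation at a point of the product as a linear functional. -/
def ev2 (z : ℍ × ℍ) : Hol2 →ₗ[ℂ] ℂ where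
  toFun f := f.1 z
  map_add' _ _ := rfl
  map_smul' _ _ := rfl

theorem hol2_sum_apply {ι : Type*} (s : Finset ι) (F : ι → Hol2) (z : ℍ × ℍ) :
    (∑ i ∈ s, F i).1 z = ∑ i ∈ s, (F i).1 z := map_sum (ev2 z) F s

theorem sub_pow_recenter (z u w : ℂ) (m : ℕ) :
    (z - w) ^ m =
      ∑ i ∈ Finset.range (m + 1), (m.choose i : ℂ) * (u - w) ^ (m - i) * (z - u) ^ i := by
  rw [show z - w = (z - u) + (u - w) by ring, add_pow]
  exact Finset.sum_congr rfl fun i _ => by ring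

theorem tens_mono1_recenter (u w₁ w₂ : ℂ) (m n : ℕ) :
    tens (mono1 w₁ m) (mono1 w₂ n) = ∑ i ∈ Finset.range (m + 1), ∑ j ∈ Finset.range (n + 1),
      ((m.choose i : ℂ) * (u - w₁) ^ (m - i) * ((n.choose j : ℂ) * (u - w₂) ^ (n - j))) •
        tens (mono1 u i) (mono1 u j) := by
  refine hol2_ext fun z => ?_
  simp only [hol2_sum_apply]
  simp only [tens_apply, mono1_apply]
  rw [sub_pow_recenter _ u w₁ m, sub_pow_recenter _ u w₂ n, Finset.sum_mul_sum]
  refine Finset.sum_congr rfl fun i _ => Finset.sum_congr rfl fun j _ => ?_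
  change _ = _ * (((z.1 : ℂ) - u) ^ i * ((z.2 : ℂ) - u) ^ j)
  ring

/-- A closed subspace contains every function that it approximates uniformly on compact sets. -/
theorem mem_of_approx {S : Submodule ℂ Hol2} (hS : IsClosed (S : Set Hol2)) {f : Hol2}
    (h : ∀ K : Set (ℍ × ℍ), IsCompact K → ∀ ε > (0 : ℝ), ∃ p ∈ S, ∀ z ∈ K, ‖p.1 z - f.1 z‖ < ε) :
    f ∈ S := by
  rw [← SetLike.mem_coe, ← hS.closure_eq]
  have hb := nhds_basis_uniformity
    (Metric.uniformity_basis_dist.compactConvergenceUniformity (α := ℍ × ℍ) (β := ℂ)) (x := f.1)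
  have hb' := hb.comap (Subtype.val : Hol2 → C(ℍ × ℍ, ℂ))
  rw [← nhds_induced] at hb'
  refine (mem_closure_iff_nhds_basis hb').2 fun i hi => ?_
  obtain ⟨p, hp, hpz⟩ := h i.1 hi.1 i.2 hi.2
  exact ⟨p, hp, fun z hz => by
    change dist (p.1 z) (f.1 z) < _
    rw [dist_eq_norm]; exact hpz z hz⟩

/-- Every compact subset of the upper half plane is contained in a disc with compact closure in
the upper half plane. -/
theorem exists_disc {K : Set ℍ} (hK : IsCompact K) :
    ∃ (c : ℍ) (ρ R : ℝ), 0 < ρ ∧ ρ < R ∧ Metric.closedBall (c : ℂ) R ⊆ U1 ∧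
      ∀ z ∈ K, (z : ℂ) ∈ Metric.closedBall (c : ℂ) ρ := by
  obtain ⟨B, hB⟩ := hK.exists_bound_of_continuousOn UpperHalfPlane.continuous_coe.continuousOn
  obtain ⟨C, hC⟩ := hK.exists_bound_of_continuousOn (f := fun z : ℍ => (z.im)⁻¹)
    (UpperHalfPlane.continuous_im.inv₀ fun z => z.im_pos.ne').continuousOn
  set η : ℝ := (max C 1)⁻¹ with hη
  have hη0 : 0 < η := by positivity
  have hKη (z : ℍ) (hz : z ∈ K) : η ≤ z.im := by
    have h1 := hC z hz
    rw [Real.norm_of_nonneg (inv_nonneg.2 z.im_pos.le)] at h1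
    have h2 : (z.im)⁻¹ ≤ max C 1 := h1.trans (le_max_left _ _)
    rw [hη]
    exact inv_le_of_inv_le₀ z.im_pos h2
  -- For `|z| ≤ B` and `Im z ≥ η`, `|z - iY|² ≤ B² - 2ηY + Y²`, which for this `Y` is less than
  -- `(Y - η / 2)²`.
  set Y : ℝ := B ^ 2 / η + η with hY
  have hYη : η ≤ Y := by
    rw [hY]
    have : 0 ≤ B ^ 2 / η := by positivity
    linarith
  have hY0 : 0 < Y := hη0.trans_le hYη
  refine ⟨⟨⟨0, Y⟩, hY0⟩, Y - η / 2, Y - η / 4, by linarith, by linarith, fun w hw => ?_,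
    fun z hz => ?_⟩
  · have h1 : |(w - (⟨0, Y⟩ : ℂ)).im| ≤ Y - η / 4 :=
      (Complex.abs_im_le_norm _).trans (mem_closedBall_iff_norm.1 hw)
    have h2 := (abs_le.1 h1).1
    simp only [Complex.sub_im] at h2
    change 0 < w.im
    linarith
  · rw [mem_closedBall_iff_norm]
    refine abs_le_of_sq_le_sq' ?_ (by linarith) |>.2
    have h1 := hB z hz
    have h2 : ‖(z : ℂ)‖ ^ 2 ≤ B ^ 2 := pow_le_pow_left₀ (norm_nonneg _) h1 2
    have h3 := hKη z hz
    have h4 : B ^ 2 = (Y - η) * η := by rw [hY]; field_simp; ring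
    rw [← Complex.normSq_eq_norm_sq, Complex.normSq_apply] at h2 ⊢
    simp only [Complex.sub_re, Complex.sub_im, UpperHalfPlane.coe_re, UpperHalfPlane.coe_im] at h2 ⊢
    nlinarith

/-- The Taylor expansion about `c` converges on a smaller disc uniformly in all functions with a
common bound. -/
theorem taylor_uniform {c : ℂ} {ρ R : ℝ} (hρ : 0 < ρ) (hR : ρ < R) (M : ℝ) {ε : ℝ} (hε : 0 < ε) :
    ∃ N : ℕ, ∀ F : ℂ → ℂ, DiffContOnCl ℂ F (Metric.ball c R) →
      (∀ z ∈ Metric.sphere c R, ‖F z‖ ≤ M) → ∀ z ∈ Metric.closedBall c ρ,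
        ‖∑ k ∈ Finset.range N, ((k.factorial : ℂ)⁻¹ * iteratedDeriv k F c) * (z - c) ^ k - F z‖
          < ε := by
  have hR0 : 0 < R := hρ.trans hR
  have hq : ρ / R < 1 := (div_lt_one hR0).2 hR
  have hlim : Filter.Tendsto (fun N : ℕ => M * (ρ / R) ^ N / (1 - ρ / R)) Filter.atTop
      (nhds 0) := by
    have := ((tendsto_pow_atTop_nhds_zero_of_lt_one (by positivity) hq).const_mul M).div_const
      (1 - ρ / R)
    simpa using this
  obtain ⟨N, hN⟩ := (hlim.eventually (gt_mem_nhds hε)).exists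
  refine ⟨N, fun F hF hM z hz => lt_of_le_of_lt ?_ hN⟩
  have hsum := Complex.hasSum_taylorSeries_on_ball hF.differentiableOn
    (Metric.closedBall_subset_ball hR hz)
  have hfun : (fun n : ℕ => ((n.factorial : ℂ))⁻¹ • (z - c) ^ n • iteratedDeriv n F c) =
      fun n : ℕ => ((n.factorial : ℂ)⁻¹ * iteratedDeriv n F c) * (z - c) ^ n := by
    ext n
    simp only [smul_eq_mul]
    ring
  rw [hfun] at hsum
  refine norm_sub_le_of_geometric_bound_of_hasSum hq (fun n => ?_) hsum N
  have hb := Complex.norm_iteratedDeriv_le_of_forall_mem_sphere_norm_le n hR0 hF hM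
  have hz' : ‖z - c‖ ≤ ρ := mem_closedBall_iff_norm.1 hz
  have hf0 : (0 : ℝ) < n.factorial := by exact_mod_cast n.factorial_pos
  rw [norm_mul, norm_mul, norm_inv, norm_pow, Complex.norm_natCast]
  calc (n.factorial : ℝ)⁻¹ * ‖iteratedDeriv n F c‖ * ‖z - c‖ ^ n
      ≤ (n.factorial : ℝ)⁻¹ * (n.factorial * M / R ^ n) * ρ ^ n :=
        mul_le_mul (mul_le_mul_of_nonneg_left hb (by positivity))
          (pow_le_pow_left₀ (norm_nonneg _) hz' n) (by positivity)
          (mul_nonneg (by positivity) ((norm_nonneg _).trans hb))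
    _ = M * (ρ / R) ^ n := by rw [div_pow]; field_simp

/-- The function `z₂ ↦ f(c, z₂)`. -/
def slice (c : ℍ) (f : Hol2) : Hol1 :=
  ⟨⟨fun z => f.1 (c, z), f.1.continuous.comp (by fun_prop)⟩, fun w hw => by
    have h : AnalyticAt ℂ (fun v : ℂ => ext2 f.1 ((c : ℂ), v)) w :=
      AnalyticAt.fun_comp (f := fun v : ℂ => ((c : ℂ), v)) (f.2 _ ⟨c.coe_im_pos, hw⟩)
        (analyticAt_const.prod analyticAt_id)
    refine h.congr (Filter.Eventually.of_forall fun v => ?_)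
    simp [ext1, ext2]⟩

@[simp] theorem slice_apply (c z : ℍ) (f : Hol2) : (slice c f).1 z = f.1 (c, z) := rfl

theorem hasDerivAt_ext2_left (f : Hol2) {w : ℂ} (hw : w ∈ U1) (z : ℍ) :
    HasDerivAt (fun v => ext2 f.1 (v, z)) (ext2 (d1 f).1 (w, z)) w := by
  have h1 : HasFDerivAt (ext2 f.1) (fderiv ℂ (ext2 f.1) (w, (z : ℂ))) (w, (z : ℂ)) :=
    (f.2 (w, (z : ℂ)) ⟨hw, z.coe_im_pos⟩).differentiableAt.hasFDerivAt
  have h2 : HasDerivAt (fun v : ℂ => (v, (z : ℂ))) ((1 : ℂ), (0 : ℂ)) w :=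
    (hasDerivAt_id w).prodMk (hasDerivAt_const w _)
  have h := h1.comp_hasDerivAt w h2
  refine HasDerivAt.congr_deriv (f := fun v => ext2 f.1 (v, z)) h ?_
  change _ = fderiv ℂ (ext2 f.1) (((ofComplex w : ℍ) : ℂ), ((ofComplex (z : ℂ) : ℍ) : ℂ)) (1, 0)
  rw [coe_ofComplex hw, ofComplex_apply]

theorem iteratedDeriv_ext2_left (k : ℕ) (f : Hol2) {w : ℂ} (hw : w ∈ U1) (z : ℍ) :
    iteratedDeriv k (fun v => ext2 f.1 (v, z)) w = ext2 ((d1 ^ k) f).1 (w, z) := by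
  induction k generalizing f with
  | zero => rfl
  | succ k ih =>
    rw [iteratedDeriv_succ', pow_succ, Module.End.mul_apply, ← ih]
    refine Filter.EventuallyEq.iteratedDeriv_eq k ?_
    filter_upwards [isOpen_U1.mem_nhds hw] with u hu
    exact (hasDerivAt_ext2_left f hu z).deriv

theorem diffContOnCl_of_U1 {F : ℂ → ℂ} {c : ℂ} {R : ℝ} (hF : ∀ w ∈ U1, DifferentiableAt ℂ F w)
    (h : Metric.closedBall c R ⊆ U1) : DiffContOnCl ℂ F (Metric.ball c R) :=
  DifferentiableOn.diffContOnCl fun w hw =>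
    (hF w (h (Metric.closure_ball_subset_closedBall hw))).differentiableWithinAt

/-- A closed subspace of `𝒪(H₊ × H₊)` that contains all polynomials is the whole space. -/
theorem mem_of_isClosed_of_mono1 {S : Submodule ℂ Hol2} (hS : IsClosed (S : Set Hol2)) (u : ℂ)
    (h : ∀ m n, tens (mono1 u m) (mono1 u n) ∈ S) (f : Hol2) : f ∈ S := by
  have hpoly (w₁ w₂ : ℂ) (m n : ℕ) : tens (mono1 w₁ m) (mono1 w₂ n) ∈ S := by
    rw [tens_mono1_recenter u]
    exact S.sum_mem fun i _ => S.sum_mem fun j _ => S.smul_mem _ (h i j)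
  -- Expanding the second factor reduces `z₁^m g(z₂)` to polynomials.
  have hhalf (w : ℂ) (m : ℕ) (g : Hol1) : tens (mono1 w m) g ∈ S := by
    refine mem_of_approx hS fun K hK ε hε => ?_
    obtain ⟨B, hB⟩ := (hK.image continuous_fst).exists_bound_of_continuousOn
      (mono1 w m).1.continuous.continuousOn
    obtain ⟨c, ρ, R, hρ, hR, hU, hKc⟩ := exists_disc (hK.image continuous_snd)
    obtain ⟨M, hM⟩ := (isCompact_closedBall (c : ℂ) R).exists_bound_of_continuousOn
      (g.2.continuousOn.mono hU)
    obtain ⟨N, hN⟩ := taylor_uniform (c := (c : ℂ)) hρ hR M (ε := ε / (|B| + 1)) (by positivity)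
    have hN' := hN _ (diffContOnCl_of_U1 (fun w hw => (g.2 w hw).differentiableAt) hU)
      fun z hz => hM z (Metric.sphere_subset_closedBall hz)
    refine ⟨∑ k ∈ Finset.range N, ((k.factorial : ℂ)⁻¹ * iteratedDeriv k (ext1 g.1) c) •
      tens (mono1 w m) (mono1 c k), S.sum_mem fun k _ => S.smul_mem _ (hpoly _ _ _ _),
      fun z hz => ?_⟩
    have h1 := hN' _ (hKc _ (Set.mem_image_of_mem _ hz))
    have h2 := hB _ (Set.mem_image_of_mem _ hz)
    rw [ext1_coe] at h1
    have h3 : (∑ k ∈ Finset.range N, ((k.factorial : ℂ)⁻¹ * iteratedDeriv k (ext1 g.1) c) •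
        tens (mono1 w m) (mono1 c k)).1 z - (tens (mono1 w m) g).1 z = (mono1 w m).1 z.1 *
        (∑ k ∈ Finset.range N, ((k.factorial : ℂ)⁻¹ * iteratedDeriv k (ext1 g.1) c) *
          ((z.2 : ℂ) - c) ^ k - g.1 z.2) := by
      rw [hol2_sum_apply, mul_sub, Finset.mul_sum]
      congr 1
      exact Finset.sum_congr rfl fun k _ => mul_left_comm _ _ _
    rw [h3, norm_mul]
    have hB' : ‖(mono1 w m).1 z.1‖ < |B| + 1 := by linarith [le_abs_self B]
    calc _ ≤ ‖(mono1 w m).1 z.1‖ * (ε / (|B| + 1)) := by gcongr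
      _ < (|B| + 1) * (ε / (|B| + 1)) := by gcongr
      _ = ε := by field_simp
  -- The Taylor coefficients in `z₁` are holomorphic functions of `z₂`, and the remainder is uniform
  -- in `z₂` because `f` is bounded on the product of a closed disc and a compact set.
  refine mem_of_approx hS fun K hK ε hε => ?_
  obtain ⟨c, ρ, R, hρ, hR, hU, hKc⟩ := exists_disc (hK.image continuous_fst)
  obtain ⟨M, hM⟩ := ((isCompact_closedBall (c : ℂ) R).prod
    ((hK.image continuous_snd).image UpperHalfPlane.continuous_coe)).exists_bound_of_continuousOn
      (f := ext2 f.1) (f.2.continuousOn.mono (by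
        rintro ⟨w, v⟩ ⟨hw, ⟨z, -, rfl⟩⟩
        exact ⟨hU hw, z.coe_im_pos⟩))
  obtain ⟨N, hN⟩ := taylor_uniform (c := (c : ℂ)) hρ hR M hε
  refine ⟨∑ k ∈ Finset.range N, (k.factorial : ℂ)⁻¹ •
    tens (mono1 c k) (slice c ((d1 ^ k) f)), S.sum_mem fun k _ => S.smul_mem _ (hhalf _ _ _),
    fun z hz => ?_⟩
  have h1 := hN (fun w => ext2 f.1 (w, z.2))
    (diffContOnCl_of_U1 (fun w hw => (hasDerivAt_ext2_left f hw z.2).differentiableAt) hU)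
    (fun w hw => hM _ ⟨Metric.sphere_subset_closedBall hw,
      Set.mem_image_of_mem _ (Set.mem_image_of_mem _ hz)⟩) _ (hKc _ (Set.mem_image_of_mem _ hz))
  convert h1 using 3
  · rw [hol2_sum_apply]
    refine Finset.sum_congr rfl fun k _ => ?_
    rw [iteratedDeriv_ext2_left k f (coe_mem_U1 c), ext2_coe _ (c, z.2)]
    change (k.factorial : ℂ)⁻¹ * (((z.1 : ℂ) - c) ^ k * ((d1 ^ k) f).1 (c, z.2)) = _
    ring
  · exact (ext2_coe _ _).symm

/-- Continuous functionals are determined by their values on the polynomials, written in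
coordinates centred at any point. -/
theorem eq_of_eq_on_mono1 {A B : Hol2 →ₗ[ℂ] Hol1} (hA : Continuous A) (hB : Continuous B) (z : ℍ)
    (u : ℂ) (h : ∀ m n, (A (tens (mono1 u m) (mono1 u n))).1 z =
      (B (tens (mono1 u m) (mono1 u n))).1 z) (f : Hol2) : (A f).1 z = (B f).1 z := by
  let S : Submodule ℂ Hol2 :=
    { carrier := {f | (A f).1 z = (B f).1 z}
      zero_mem' := by simp
      add_mem' := fun {f g} hf hg => by
        simp only [Set.mem_ofPred_eq, map_add] at *
        exact congrArg₂ (· + ·) hf hg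
      smul_mem' := fun c f hf => by
        simp only [Set.mem_ofPred_eq, map_smul] at *
        exact congrArg (c * ·) hf }
  have hS : IsClosed (S : Set Hol2) :=
    isClosed_eq ((continuous_eval_hol1 z).comp hA) ((continuous_eval_hol1 z).comp hB)
  exact mem_of_isClosed_of_mono1 hS u h f

/-! ### Bidifferential operators with constant coefficients -/

/-- The operator `f ↦ ∑_{l ≤ a} b_l / ((a - l)! l!) (∂₁^(a-l) ∂₂^l f)(z, z)`. The factorials make
`b_l` the value on `(z₁ - z)^(a-l) (z₂ - z)^l`. -/
def bidiff (a : ℕ) (b : ℕ → ℂ) : Hol2 →ₗ[ℂ] Hol1 :=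
  ∑ l ∈ Finset.range (a + 1), (b l / (((a - l).factorial : ℂ) * (l.factorial : ℂ))) • jet (a - l) l

/-- Evaluation at a point of the upper half plane as a linear functional. -/
def ev1 (z : ℍ) : Hol1 →ₗ[ℂ] ℂ where
  toFun f := f.1 z
  map_add' _ _ := rfl
  map_smul' _ _ := rfl

theorem bidiff_apply (a : ℕ) (b : ℕ → ℂ) (f : Hol2) (z : ℍ) :
    (bidiff a b f).1 z = ∑ l ∈ Finset.range (a + 1),
      b l / (((a - l).factorial : ℂ) * (l.factorial : ℂ)) * (jet (a - l) l f).1 z := by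
  change ev1 z (bidiff a b f) = _
  rw [bidiff, LinearMap.sum_apply, map_sum]
  rfl

theorem continuous_bidiff (a : ℕ) (b : ℕ → ℂ) : Continuous (bidiff a b) := by
  unfold bidiff
  refine Finset.sum_induction _ (fun T : Hol2 →ₗ[ℂ] Hol1 => Continuous T)
    (fun S T hS hT => continuous_add_hol1 hS hT) continuous_const
    fun l _ => continuous_smul_hol1 _ (continuous_jet _ _)

theorem bidiff_congr {a : ℕ} {b b' : ℕ → ℂ} (h : ∀ l ≤ a, b l = b' l) :
    bidiff a b = bidiff a b' :=
  Finset.sum_congr rfl fun l hl => by rw [h l (by simpa [Nat.lt_succ_iff] using hl)]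

theorem bidiff_add (a : ℕ) (b b' : ℕ → ℂ) : bidiff a (b + b') = bidiff a b + bidiff a b' := by
  simp only [bidiff, Pi.add_apply, add_div, add_smul, Finset.sum_add_distrib]

theorem bidiff_smul (a : ℕ) (c : ℂ) (b : ℕ → ℂ) : bidiff a (c • b) = c • bidiff a b := by
  simp only [bidiff, Pi.smul_apply, smul_eq_mul, mul_div_assoc, mul_smul, Finset.smul_sum]

theorem bidiff_mono1 (a : ℕ) (b : ℕ → ℂ) (z : ℍ) (m n : ℕ) :
    (bidiff a b (tens (mono1 z m) (mono1 z n))).1 z = if m + n = a then b n else 0 := by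
  simp only [bidiff_apply, jet_tens, der_iterate_mono1]
  split_ifs with h
  · rw [Finset.sum_eq_single n]
    · rw [if_pos (by omega), if_pos rfl, show a - n = m by omega]
      have h1 : (m.factorial : ℂ) ≠ 0 := by exact_mod_cast m.factorial_ne_zero
      have h2 : (n.factorial : ℂ) ≠ 0 := by exact_mod_cast n.factorial_ne_zero
      field_simp
    · intro l _ hl
      rw [if_neg hl]; simp
    · intro hn
      exact absurd (Finset.mem_range.2 (by omega)) hn
  · refine Finset.sum_eq_zero fun l hl => ?_
    have hl' := Finset.mem_range.1 hl
    by_cases h2 : l = n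
    · rw [if_neg (show ¬ a - l = m by omega)]; simp
    · rw [if_neg h2]; simp

theorem bidiff_injective {a : ℕ} {b b' : ℕ → ℂ} (h : bidiff a b = bidiff a b') {l : ℕ}
    (hl : l ≤ a) : b l = b' l := by
  have h1 := bidiff_mono1 a b I (a - l) l
  have h2 := bidiff_mono1 a b' I (a - l) l
  rw [if_pos (by omega)] at h1 h2
  rw [← h1, ← h2, h]

theorem jet_slash2_mono1 (lam₁ lam₂ : ℂ) (h : SL2Cover) (z : ℍ) (m n k l : ℕ) :
    (jet k l (slash2 lam₁ lam₂ h (tens (mono1 ((h.mat • z : ℍ) : ℂ) m)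
      (mono1 ((h.mat • z : ℍ) : ℂ) n)))).1 z =
      Complex.exp (-(lam₁ + lam₂ + k + l + m + n) * h.log.1 z) *
        ((k.descFactorial m * (-((h.mat 1 0 : ℝ) : ℂ)) ^ (k - m) *
          (ascPochhammer ℂ (k - m)).eval (lam₁ + m)) *
        (l.descFactorial n * (-((h.mat 1 0 : ℝ) : ℂ)) ^ (l - n) *
          (ascPochhammer ℂ (l - n)).eval (lam₂ + n))) := by
  have h3 (c : ℂ) (u : Hol1) : (c • u).1 z = c * u.1 z := rfl
  rw [slash2_tens, slash1_mono1, slash1_mono1, jet_tens, der_iterate_smul, der_iterate_smul, h3, h3,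
    der_iterate_mono1_mul1, der_iterate_mono1_mul1, der_iterate_autom, der_iterate_autom, h3, h3,
    autom_apply, autom_apply]
  rcases lt_or_ge k m with hk | hk
  · simp [Nat.descFactorial_of_lt hk]
  rcases lt_or_ge l n with hl | hl
  · simp [Nat.descFactorial_of_lt hl]
  rw [show -(lam₁ + lam₂ + k + l + m + n) * h.log.1 z = -(m : ℂ) * h.log.1 z +
    -(n : ℂ) * h.log.1 z + -(lam₁ + m + (k - m : ℕ)) * h.log.1 z +
    -(lam₂ + n + (l - n : ℕ)) * h.log.1 z by push_cast [hk, hl]; ring, Complex.exp_add,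
    Complex.exp_add, Complex.exp_add]
  ring

theorem descFactorial_div_factorial {k m : ℕ} (h : m ≤ k) :
    (k.descFactorial m : ℂ) / k.factorial = 1 / (k - m).factorial := by
  have h1 : ((k - m).factorial : ℂ) * k.descFactorial m = k.factorial := by
    exact_mod_cast Nat.factorial_mul_descFactorial h
  have h2 : ((k - m).factorial : ℂ) ≠ 0 := by exact_mod_cast (k - m).factorial_ne_zero
  have h3 : (k.factorial : ℂ) ≠ 0 := by exact_mod_cast k.factorial_ne_zero
  rw [div_eq_div_iff h3 h2, ← h1]
  ring

/-- The left hand side of the intertwining relation on a monomial of degree `a - k`, where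
`a = m + n + k`, as a factor independent of `b` times a sum over `k + 1` consecutive `b_l`. -/
theorem bidiff_slash2_mono1 (lam₁ lam₂ : ℂ) (h : SL2Cover) (z : ℍ) (m n k : ℕ) (b : ℕ → ℂ) :
    (bidiff (m + n + k) b (slash2 lam₁ lam₂ h (tens (mono1 ((h.mat • z : ℍ) : ℂ) m)
      (mono1 ((h.mat • z : ℍ) : ℂ) n)))).1 z =
      Complex.exp (-(lam₁ + lam₂ + (m + n + k) + m + n) * h.log.1 z) *
        (-((h.mat 1 0 : ℝ) : ℂ)) ^ k * ∑ j ∈ Finset.range (k + 1),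
          b (n + j) / ((k - j).factorial * j.factorial) *
            ((ascPochhammer ℂ (k - j)).eval (lam₁ + m) *
              (ascPochhammer ℂ j).eval (lam₂ + n)) := by
  rw [bidiff_apply]
  have hsub : Finset.Ico n (n + (k + 1)) ⊆ Finset.range (m + n + k + 1) := fun l hl => by
    rw [Finset.mem_Ico] at hl
    rw [Finset.mem_range]
    omega
  rw [← Finset.sum_subset hsub, Finset.sum_Ico_eq_sum_range, Finset.mul_sum]
  · rw [Nat.add_sub_cancel_left]
    refine Finset.sum_congr rfl fun j hj => ?_
    obtain ⟨i, rfl⟩ : ∃ i, k = i + j :=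
      ⟨k - j, by have := Finset.mem_range.1 hj; omega⟩
    rw [jet_slash2_mono1, show m + n + (i + j) - (n + j) = m + i by omega,
      show n + j - n = j by omega, show m + i - m = i by omega, show i + j - j = i by omega]
    have e1 := descFactorial_div_factorial (show m ≤ m + i by omega)
    have e2 := descFactorial_div_factorial (show n ≤ n + j by omega)
    rw [show m + i - m = i by omega] at e1
    rw [show n + j - n = j by omega] at e2
    rw [show -(lam₁ + lam₂ + ((m + i : ℕ) : ℂ) + ((n + j : ℕ) : ℂ) + m + n) * h.log.1 z =
      -(lam₁ + lam₂ + (m + n + ((i + j : ℕ) : ℂ)) + m + n) * h.log.1 z by push_cast; ring]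
    set E := Complex.exp (-(lam₁ + lam₂ + (m + n + ((i + j : ℕ) : ℂ)) + m + n) * h.log.1 z)
    set c : ℂ := -((h.mat 1 0 : ℝ) : ℂ)
    calc _ = E * c ^ (i + j) * (b (n + j) * (((m + i).descFactorial m : ℂ) / (m + i).factorial *
          (((n + j).descFactorial n : ℂ) / (n + j).factorial)) *
            ((ascPochhammer ℂ i).eval (lam₁ + m) * (ascPochhammer ℂ j).eval (lam₂ + n))) := by
            rw [pow_add]; ring
      _ = _ := by rw [e1, e2]; ring
  · intro l hl hl'
    rw [Finset.mem_range] at hl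
    rw [Finset.mem_Ico] at hl'
    rw [jet_slash2_mono1]
    rcases lt_or_ge l n with h1 | h1
    · simp [Nat.descFactorial_of_lt h1]
    · simp [Nat.descFactorial_of_lt (show m + n + k - l < m by omega)]

/-- The recurrence satisfied by the coefficients of an equivariant operator. -/
def Recurrence (lam₁ lam₂ : ℂ) (a : ℕ) (b : ℕ → ℂ) : Prop :=
  ∀ n < a, (lam₁ + a - 1 - n) * b n + (lam₂ + n) * b (n + 1) = 0

/-- The recurrence iterated `j` times, without division. -/
theorem Recurrence.mul_ascPochhammer {lam₁ lam₂ : ℂ} {m n k : ℕ} {b : ℕ → ℂ}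
    (hb : Recurrence lam₁ lam₂ (m + n + k) b) (j : ℕ) (hj : j ≤ k) :
    b (n + j) * (ascPochhammer ℂ j).eval (lam₂ + n) =
      (-1) ^ j * b n * (ascPochhammer ℂ j).eval (lam₁ + m + (k - j : ℕ)) := by
  induction j with
  | zero => simp
  | succ j ih =>
    have h1 := hb (n + j) (by omega)
    have h2 := ih (by omega)
    have e : lam₁ + m + ((k - j : ℕ) : ℂ) = lam₁ + m + ((k - (j + 1) : ℕ) : ℂ) + 1 := by
      rw [show k - j = k - (j + 1) + 1 by omega]; push_cast; ring
    have e2 : lam₁ + ((m + n + k : ℕ) : ℂ) - 1 - ((n + j : ℕ) : ℂ) =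
        lam₁ + m + ((k - (j + 1) : ℕ) : ℂ) := by
      push_cast [hj]; ring
    rw [e2] at h1
    rw [ascPochhammer_succ_eval, ascPochhammer_succ_left, Polynomial.eval_mul,
      Polynomial.eval_comp]
    simp only [Polynomial.eval_X, Polynomial.eval_add, Polynomial.eval_one]
    rw [← e]
    push_cast at h1
    rw [← add_assoc n j 1]
    linear_combination (ascPochhammer ℂ j).eval (lam₂ + n) * h1 -
      (lam₁ + m + ((k - (j + 1) : ℕ) : ℂ)) * h2

/-- The recurrence annihilates all lower order terms, by the alternating sum of binomial
coefficients. -/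
theorem Recurrence.sum_eq_zero {lam₁ lam₂ : ℂ} {m n k : ℕ} {b : ℕ → ℂ}
    (hb : Recurrence lam₁ lam₂ (m + n + k) b) (hk : k ≠ 0) :
    ∑ j ∈ Finset.range (k + 1), b (n + j) / ((k - j).factorial * j.factorial) *
      ((ascPochhammer ℂ (k - j)).eval (lam₁ + m) * (ascPochhammer ℂ j).eval (lam₂ + n)) = 0 := by
  have hk0 : (k.factorial : ℂ) ≠ 0 := by exact_mod_cast k.factorial_ne_zero
  have hterm (j : ℕ) (hj : j ∈ Finset.range (k + 1)) :
      b (n + j) / ((k - j).factorial * j.factorial) *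
        ((ascPochhammer ℂ (k - j)).eval (lam₁ + m) * (ascPochhammer ℂ j).eval (lam₂ + n)) =
      b n * (ascPochhammer ℂ k).eval (lam₁ + m) / k.factorial * ((-1) ^ j * (k.choose j : ℂ)) := by
    have hj' : j ≤ k := by have := Finset.mem_range.1 hj; omega
    have h1 := hb.mul_ascPochhammer j hj'
    have h2 : (ascPochhammer ℂ k).eval (lam₁ + m) = (ascPochhammer ℂ (k - j)).eval (lam₁ + m) *
        (ascPochhammer ℂ j).eval (lam₁ + m + (k - j : ℕ)) := by
      have := ascPochhammer_mul ℂ (k - j) j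
      rw [Nat.sub_add_cancel hj'] at this
      rw [← this, Polynomial.eval_mul, Polynomial.eval_comp]
      simp
    have h3 : ((k.choose j : ℕ) : ℂ) = k.factorial / (j.factorial * (k - j).factorial) :=
      Nat.cast_choose ℂ hj'
    have h4 : ((k - j).factorial : ℂ) ≠ 0 := by exact_mod_cast (k - j).factorial_ne_zero
    have h5 : (j.factorial : ℂ) ≠ 0 := by exact_mod_cast j.factorial_ne_zero
    rw [h2, h3]
    field_simp
    linear_combination (ascPochhammer ℂ (k - j)).eval (lam₁ + m) * h1
  rw [Finset.sum_congr rfl hterm, ← Finset.mul_sum]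
  have h := Int.alternating_sum_range_choose_of_ne hk
  have h' : ∑ j ∈ Finset.range (k + 1), ((-1) ^ j * (k.choose j : ℂ)) = 0 := by exact_mod_cast h
  rw [h', mul_zero]

/-- The intertwining relation without the inversion in the definition of the representations. -/
theorem mem_intertwiners_iff {lam₁ lam₂ lam₃ : ℂ} {T : Hol2 →ₗ[ℂ] Hol1} :
    T ∈ intertwiners lam₁ lam₂ lam₃ ↔ Continuous T ∧
      ∀ h f, T (slash2 lam₁ lam₂ h f) = slash1 lam₃ h (T f) := by
  refine and_congr_right fun _ => ⟨fun H h f => ?_, fun H g f => H g⁻¹ f⟩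
  have := H h⁻¹ f
  change T (slash2 lam₁ lam₂ h⁻¹⁻¹ f) = slash1 lam₃ h⁻¹⁻¹ (T f) at this
  rwa [inv_inv] at this

theorem bidiff_mem_intertwiners {lam₁ lam₂ lam₃ : ℂ} {a : ℕ} {b : ℕ → ℂ}
    (h3 : lam₃ - lam₁ - lam₂ = 2 * (a : ℂ)) (hb : Recurrence lam₁ lam₂ a b) :
    bidiff a b ∈ intertwiners lam₁ lam₂ lam₃ := by
  refine mem_intertwiners_iff.2 ⟨continuous_bidiff a b, fun h f => hol1_ext fun z => ?_⟩
  refine eq_of_eq_on_mono1 (A := bidiff a b ∘ₗ slash2 lam₁ lam₂ h)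
    (B := slash1 lam₃ h ∘ₗ bidiff a b) ((continuous_bidiff a b).comp (continuous_slash2 _ _ _))
    ((continuous_slash1 _ _).comp (continuous_bidiff a b)) z ((h.mat • z : ℍ) : ℂ)
    (fun m n => ?_) f
  rw [LinearMap.comp_apply, LinearMap.comp_apply, slash1_apply, bidiff_mono1]
  split_ifs with hmn
  · have h1 := bidiff_slash2_mono1 lam₁ lam₂ h z m n 0 b
    subst hmn
    rw [add_zero] at h1
    rw [h1]
    have e : lam₁ + lam₂ + (m + n + ((0 : ℕ) : ℂ)) + m + n = lam₃ := by
      push_cast at h3 ⊢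
      linear_combination -h3
    rw [e]
    simp
  · rcases lt_or_ge a (m + n) with hlt | hge
    · rw [mul_zero, bidiff_apply]
      refine Finset.sum_eq_zero fun l hl => ?_
      rw [Finset.mem_range] at hl
      rw [jet_slash2_mono1]
      rcases lt_or_ge l n with h1 | h1
      · simp [Nat.descFactorial_of_lt h1]
      · simp [Nat.descFactorial_of_lt (show a - l < m by omega)]
    · obtain ⟨k, rfl⟩ := Nat.exists_eq_add_of_le hge
      rw [bidiff_slash2_mono1, hb.sum_eq_zero (by omega), mul_zero, mul_zero]

/-! ### Translations, dilations and a lower unipotent element of the covering group -/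

/-- A constant function. -/
def const1 (c : ℂ) : Hol1 := ofAnalytic (fun _ => c) fun _ _ => analyticAt_const

/-- The lift of the translation `z ↦ z + x`. -/
def translation (x : ℝ) : SL2Cover where
  mat := ⟨!![1, x; 0, 1], by simp [Matrix.det_fin_two]⟩
  log := 0
  exp_log z := by simp

/-- The lift of the dilation `z ↦ e^(2s) z`. -/
def dilation (s : ℝ) : SL2Cover where
  mat := ⟨!![Real.exp s, 0; 0, Real.exp (-s)], by simp [Matrix.det_fin_two, ← Real.exp_add]⟩
  log := const1 (-s)
  exp_log z := by
    change Complex.exp (-(s : ℂ)) = _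
    simp

/-- A lift of `z ↦ z / (z + 1)`. -/
def lowerUnipotent : SL2Cover where
  mat := ⟨!![1, 0; 1, 1], by simp [Matrix.det_fin_two]⟩
  log := ofAnalytic (fun z => Complex.log (z + 1)) fun w hw =>
    (analyticAt_id.add analyticAt_const).clog (Or.inr (by
      have : 0 < w.im := hw
      simpa using this.ne'))
  exp_log z := by
    have : (z : ℂ) + 1 ≠ 0 := fun h => by
      have h1 := congrArg Complex.im h
      simp only [Complex.add_im, UpperHalfPlane.coe_im, Complex.one_im, add_zero,
        Complex.zero_im] at h1
      exact z.im_pos.ne' h1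
    exact (Complex.exp_log this).trans (by simp)

/-- Necessity of the recurrence: apply the intertwining relation for an element with `c = 1` to the
monomials of degree `a - 1`, on which one side vanishes. -/
theorem recurrence_of_mem_intertwiners {lam₁ lam₂ lam₃ : ℂ} {a : ℕ} {b : ℕ → ℂ}
    (h : bidiff a b ∈ intertwiners lam₁ lam₂ lam₃) : Recurrence lam₁ lam₂ a b := by
  intro n hn
  obtain ⟨m, rfl⟩ : ∃ m, a = m + n + 1 := ⟨a - n - 1, by omega⟩
  have h1 := bidiff_slash2_mono1 lam₁ lam₂ lowerUnipotent I m n 1 b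
  rw [(mem_intertwiners_iff.1 h).2, slash1_apply, bidiff_mono1, if_neg (by omega), mul_zero] at h1
  have hc : ((lowerUnipotent.mat 1 0 : ℝ) : ℂ) = 1 := by simp [lowerUnipotent]
  rw [hc] at h1
  have h2 := (mul_eq_zero.1 h1.symm).resolve_left
    (mul_ne_zero (Complex.exp_ne_zero _) (by norm_num))
  simp [Finset.sum_range_succ] at h2
  push_cast
  linear_combination h2

theorem coe_translation_smul (x : ℝ) (z : ℍ) :
    (((translation x).mat • z : ℍ) : ℂ) = z + x := by
  rw [coe_specialLinearGroup_apply]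
  simp [translation]

theorem coe_dilation_smul (s : ℝ) (z : ℍ) :
    (((dilation s).mat • z : ℍ) : ℂ) = Complex.exp (2 * s) * z := by
  rw [coe_specialLinearGroup_apply]
  simp [dilation, two_mul, Complex.exp_add, Complex.exp_neg]
  ring

/-! ### Every intertwining operator is a bidifferential operator -/

/-- Two analytic functions that agree on a horizontal line are equal. -/
theorem eqOn_of_eq_add_real {U : Set ℂ} (hU : IsPreconnected U) {F G : ℂ → ℂ}
    (hF : AnalyticOnNhd ℂ F U) (hG : AnalyticOnNhd ℂ G U) {z₀ : ℂ} (hz₀ : z₀ ∈ U)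
    (h : ∀ x : ℝ, F (z₀ + x) = G (z₀ + x)) : Set.EqOn F G U := by
  refine hF.eqOn_of_preconnected_of_frequently_eq hG hU hz₀ ?_
  have ht : Filter.Tendsto (fun x : ℝ => z₀ + (x : ℂ)) (nhdsWithin 0 {0}ᶜ)
      (nhdsWithin z₀ {z₀}ᶜ) := by
    refine tendsto_nhdsWithin_of_tendsto_nhds_of_eventually_within _ ?_ ?_
    · have : Continuous fun x : ℝ => z₀ + (x : ℂ) := by fun_prop
      have h0 := this.tendsto 0
      simp only [Complex.ofReal_zero, add_zero] at h0
      exact h0.mono_left nhdsWithin_le_nhds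
    · filter_upwards [self_mem_nhdsWithin] with x hx
      simpa using hx
  exact ht.frequently (Filter.Frequently.of_forall h)

theorem isPreconnected_U1 : IsPreconnected U1 :=
  (convex_halfSpace_im_gt 0).isPreconnected

theorem eq_zero_of_exp_mul_eq_one {κ : ℂ} (h : ∀ s : ℝ, Complex.exp (κ * s) = 1) :
    κ = 0 := by
  have h1 : HasDerivAt (fun s : ℝ => Complex.exp (κ * s)) (Complex.exp (κ * (0 : ℝ)) * (κ * 1)) 0 :=
    ((Complex.ofRealCLM.hasDerivAt (x := (0 : ℝ))).const_mul κ).cexp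
  have h2 : HasDerivAt (fun s : ℝ => Complex.exp (κ * s)) 0 0 := by
    rw [funext h]
    exact hasDerivAt_const _ _
  simpa using h1.unique h2

theorem slash2_translation (lam₁ lam₂ : ℂ) (x : ℝ) (w : ℂ) (m n : ℕ) :
    slash2 lam₁ lam₂ (translation x) (tens (mono1 w m) (mono1 w n)) =
      tens (mono1 (w - x) m) (mono1 (w - x) n) := by
  refine hol2_ext fun z => ?_
  have h0 (z : ℍ) : (translation x).log.1 z = 0 := rfl
  simp only [slash2_apply, tens_apply, mono1_apply, coe_translation_smul, h0, mul_zero,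
    Complex.exp_zero, one_mul]
  rw [sub_sub_eq_add_sub, sub_sub_eq_add_sub]

theorem slash2_dilation (lam₁ lam₂ : ℂ) (s : ℝ) (m n : ℕ) :
    slash2 lam₁ lam₂ (dilation s) (tens (mono1 0 m) (mono1 0 n)) =
      Complex.exp ((lam₁ + lam₂ + 2 * (m + n)) * s) • tens (mono1 0 m) (mono1 0 n) := by
  refine hol2_ext fun z => ?_
  have h0 (z : ℍ) : (dilation s).log.1 z = -s := rfl
  have h3 (c : ℂ) (u : Hol2) : (c • u).1 z = c * u.1 z := rfl
  simp only [slash2_apply, h3, tens_apply, mono1_apply, coe_dilation_smul, h0, sub_zero, mul_pow,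
    ← Complex.exp_nat_mul]
  rw [show (lam₁ + lam₂ + 2 * (m + n)) * (s : ℂ) = -lam₁ * -s + -lam₂ * -s + m * (2 * s) +
    n * (2 * s) by ring, Complex.exp_add, Complex.exp_add, Complex.exp_add]
  ring

/-- The value of an intertwining operator on a monomial centred at `z`, at the point `z`, does not
depend on `z`, and vanishes except in one degree. Indeed translations make the image of
`z₁^m z₂^n` a polynomial `p`, that value is `p(0)`, and dilations make `p` homogeneous. -/
theorem exists_values_of_mem_intertwiners {lam₁ lam₂ lam₃ : ℂ} {T : Hol2 →ₗ[ℂ] Hol1}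
    (hT : T ∈ intertwiners lam₁ lam₂ lam₃) (m n : ℕ) :
    ∃ β : ℂ, (∀ z : ℍ, (T (tens (mono1 z m) (mono1 z n))).1 z = β) ∧
      (β ≠ 0 → lam₃ - lam₁ - lam₂ = 2 * ((m + n : ℕ) : ℂ)) := by
  have hT' := (mem_intertwiners_iff.1 hT).2
  set q : ℂ → ℍ → ℂ := fun w z => (T (tens (mono1 w m) (mono1 w n))).1 z with hq
  set G : Hol1 := T (tens (mono1 0 m) (mono1 0 n)) with hG
  have hana (z : ℍ) (w : ℂ) : AnalyticAt ℂ (fun w => q w z) w := by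
    have e (w : ℂ) : q w z = ∑ i ∈ Finset.range (m + 1), ∑ j ∈ Finset.range (n + 1),
        ((m.choose i : ℂ) * (0 - w) ^ (m - i) * ((n.choose j : ℂ) * (0 - w) ^ (n - j))) *
          (T (tens (mono1 0 i) (mono1 0 j))).1 z := by
      change (ev1 z ∘ₗ T) (tens (mono1 w m) (mono1 w n)) = _
      rw [tens_mono1_recenter 0]
      simp only [map_sum, map_smul]
      rfl
    rw [funext e]
    fun_prop
  have htrans (x : ℝ) (w : ℂ) (z : ℍ) : q (w - x) z = q w ((translation x).mat • z) := by
    have h1 := congrArg (fun F : Hol1 => F.1 z) (hT' (translation x) (tens (mono1 w m) (mono1 w n)))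
    simp only [slash2_translation, slash1_apply] at h1
    have h0 : (translation x).log.1 z = 0 := rfl
    rw [h0, mul_zero, Complex.exp_zero, one_mul] at h1
    exact h1
  have hdil (s : ℝ) (z : ℍ) : ext1 G.1 (Complex.exp (2 * s) * z) =
      Complex.exp ((lam₁ + lam₂ + 2 * (m + n) - lam₃) * s) * ext1 G.1 z := by
    have h1 := congrArg (fun F : Hol1 => F.1 z) (hT' (dilation s) (tens (mono1 0 m) (mono1 0 n)))
    simp only [slash2_dilation, slash1_apply, map_smul] at h1
    have h0 : (dilation s).log.1 z = -s := rfl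
    have h2 (c : ℂ) (u : Hol1) : (c • u).1 z = c * u.1 z := rfl
    rw [h0, h2, ← hG] at h1
    rw [← coe_dilation_smul, ext1_coe, ext1_coe, sub_mul, Complex.exp_sub, div_mul_eq_mul_div, h1,
      neg_mul_neg]
    field_simp
  set p : ℂ → ℂ := fun v => q (I - v) I with hp
  have hpana (v : ℂ) : AnalyticAt ℂ p v :=
    AnalyticAt.fun_comp (g := fun w => q w I) (hana I _) (analyticAt_const.sub analyticAt_id)
  -- The two sides agree on the line `Im v = 1`, where `v` is a translate of `i`.
  have hGp : Set.EqOn (ext1 G.1) p U1 := by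
    refine eqOn_of_eq_add_real isPreconnected_U1 G.2 (fun v _ => hpana v) (coe_mem_U1 I)
      fun x => ?_
    rw [← coe_translation_smul, ext1_coe]
    have := htrans x 0 I
    rw [hp, coe_translation_smul]
    simp only [sub_add_cancel_left]
    rw [← zero_sub, this]
  -- For real `w` this is equivariance under translations; both sides are entire in `w`.
  have hqp (z : ℍ) (w : ℂ) : q w z = p (z - w) := by
    have hpz : AnalyticOnNhd ℂ (fun w => p (z - w)) Set.univ := fun w _ =>
      AnalyticAt.fun_comp (g := p) (hpana _) (analyticAt_const.sub analyticAt_id)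
    refine eqOn_of_eq_add_real isPreconnected_univ (fun w _ => hana z w) hpz
      (Set.mem_univ 0) (fun x => ?_) (Set.mem_univ w)
    have h1 := htrans (-x) 0 z
    have h2 := hGp (coe_mem_U1 ((translation (-x)).mat • z))
    rw [ext1_coe, coe_translation_smul] at h2
    simp only [Complex.ofReal_neg, sub_neg_eq_add, zero_add, ← sub_eq_add_neg] at h1 h2 ⊢
    rw [h1, ← h2]
  -- Homogeneity under dilations extends from the upper half plane to the origin.
  have hhom (s : ℝ) : p 0 = Complex.exp ((lam₁ + lam₂ + 2 * (m + n) - lam₃) * s) * p 0 := by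
    have hl : AnalyticOnNhd ℂ (fun v => p (Complex.exp (2 * s) * v)) Set.univ := fun w _ =>
      AnalyticAt.fun_comp (g := p) (hpana _) (analyticAt_const.mul analyticAt_id)
    have hr : AnalyticOnNhd ℂ
        (fun v => Complex.exp ((lam₁ + lam₂ + 2 * (m + n) - lam₃) * s) * p v) Set.univ :=
      fun w _ => analyticAt_const.mul (hpana w)
    have h1 := eqOn_of_eq_add_real isPreconnected_univ hl hr (Set.mem_univ (I : ℂ))
      (fun x => ?_) (Set.mem_univ 0)
    · simpa using h1
    · have h2 := hdil s ((translation x).mat • I)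
      rw [hGp (coe_mem_U1 _), ← coe_dilation_smul, hGp (coe_mem_U1 _), coe_dilation_smul,
        coe_translation_smul] at h2
      exact h2
  refine ⟨p 0, fun z => ?_, fun h => ?_⟩
  · have := hqp z z
    rwa [sub_self] at this
  · have h1 : lam₁ + lam₂ + 2 * (m + n) - lam₃ = 0 :=
      eq_zero_of_exp_mul_eq_one fun s => (mul_eq_right₀ h).1 (hhom s).symm
    push_cast
    linear_combination -h1

theorem eq_bidiff_of_mem_intertwiners {lam₁ lam₂ lam₃ : ℂ} {T : Hol2 →ₗ[ℂ] Hol1}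
    (hT : T ∈ intertwiners lam₁ lam₂ lam₃) {a : ℕ} (h3 : lam₃ - lam₁ - lam₂ = 2 * (a : ℂ)) :
    ∃ b, T = bidiff a b ∧ Recurrence lam₁ lam₂ a b := by
  choose β hβ hβ0 using exists_values_of_mem_intertwiners hT
  have hTb : T = bidiff a fun l => β (a - l) l := by
    refine LinearMap.ext fun f => hol1_ext fun z => ?_
    refine eq_of_eq_on_mono1 (mem_intertwiners_iff.1 hT).1 (continuous_bidiff _ _) z z
      (fun m n => ?_) f
    rw [hβ, bidiff_mono1]
    split_ifs with h
    · rw [show a - n = m by omega]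
    · by_contra h0
      have h1 := (hβ0 m n h0).symm.trans h3
      have h2 : ((m + n : ℕ) : ℂ) = (a : ℂ) := mul_left_cancel₀ two_ne_zero h1
      exact h (by exact_mod_cast h2)
  refine ⟨_, hTb, ?_⟩
  rw [hTb] at hT
  exact recurrence_of_mem_intertwiners hT

theorem eq_zero_of_mem_intertwiners {lam₁ lam₂ lam₃ : ℂ} {T : Hol2 →ₗ[ℂ] Hol1}
    (hT : T ∈ intertwiners lam₁ lam₂ lam₃) (h3 : (lam₁, lam₂, lam₃) ∉ Omega) : T = 0 := by
  refine LinearMap.ext fun f => hol1_ext fun z => ?_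
  refine eq_of_eq_on_mono1 (mem_intertwiners_iff.1 hT).1 (B := 0) continuous_const z z
    (fun m n => ?_) f
  obtain ⟨β, hβ, hβ0⟩ := exists_values_of_mem_intertwiners hT m n
  rw [hβ]
  by_contra h0
  exact h3 ⟨m + n, hβ0 h0⟩

theorem isDifferential_bidiff (a : ℕ) (b : ℕ → ℂ) : IsDifferential (bidiff a b) := by
  refine ⟨a + 1, fun i j => const1 (if i + j = a then
    b j / ((i.factorial : ℂ) * (j.factorial : ℂ)) else 0), fun f z => ?_⟩
  rw [bidiff_apply, Finset.sum_comm]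
  refine Finset.sum_congr rfl fun l hl => ?_
  rw [Finset.mem_range] at hl
  rw [Finset.sum_eq_single (a - l)]
  · rw [jet_apply]
    change _ =
      (if a - l + l = a then b l / (((a - l).factorial : ℂ) * (l.factorial : ℂ)) else 0) * _
    rw [if_pos (by omega)]
  · intro i _ hi
    change (if i + l = a then b l / ((i.factorial : ℂ) * (l.factorial : ℂ)) else 0) * _ = 0
    rw [if_neg (by omega), zero_mul]
  · intro h
    exact absurd (Finset.mem_range.2 (by omega)) h

/-! ### The solutions of the recurrence -/

theorem Recurrence.add {lam₁ lam₂ : ℂ} {a : ℕ} {b b' : ℕ → ℂ} (hb : Recurrence lam₁ lam₂ a b)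
    (hb' : Recurrence lam₁ lam₂ a b') : Recurrence lam₁ lam₂ a (b + b') := fun n hn => by
  simp only [Pi.add_apply]
  linear_combination hb n hn + hb' n hn

theorem Recurrence.smul {lam₁ lam₂ : ℂ} {a : ℕ} {b : ℕ → ℂ} (c : ℂ)
    (hb : Recurrence lam₁ lam₂ a b) : Recurrence lam₁ lam₂ a (c • b) := fun n hn => by
  simp only [Pi.smul_apply, smul_eq_mul]
  linear_combination c * hb n hn

theorem Recurrence.eq_zero_of_le {lam₁ lam₂ : ℂ} {a : ℕ} {b : ℕ → ℂ}
    (hb : Recurrence lam₁ lam₂ a b) {l : ℕ} (hl : l ≤ a) (h0 : b l = 0)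
    (hp : ∀ n < l, lam₁ + a - 1 - n ≠ 0) {n : ℕ} (hn : n ≤ l) : b n = 0 := by
  induction hn using Nat.decreasingInduction with
  | self => exact h0
  | of_succ n hn ih =>
    have h := hb n (by omega)
    rw [ih, mul_zero, add_zero] at h
    exact (mul_eq_zero.1 h).resolve_left (hp n hn)

theorem Recurrence.eq_zero_of_ge {lam₁ lam₂ : ℂ} {a : ℕ} {b : ℕ → ℂ}
    (hb : Recurrence lam₁ lam₂ a b) {l m : ℕ} (hm : m ≤ a) (h0 : b l = 0)
    (hq : ∀ n, l ≤ n → n < m → lam₂ + n ≠ 0) {n : ℕ} (hn : l ≤ n) (hnm : n ≤ m) : b n = 0 := by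
  induction n, hn using Nat.le_induction with
  | base => exact h0
  | succ n hn ih =>
    have h := hb n (by omega)
    rw [ih (by omega), mul_zero, zero_add] at h
    exact (mul_eq_zero.1 h).resolve_left (hq n hn (by omega))

theorem ascPochhammer_eval_succ_left (k : ℕ) (x : ℂ) :
    (ascPochhammer ℂ (k + 1)).eval x = x * (ascPochhammer ℂ k).eval (x + 1) := by
  rw [ascPochhammer_succ_left, Polynomial.eval_mul, Polynomial.eval_comp]
  simp

theorem ascPochhammer_eval_natCast_succ (k n : ℕ) :
    (ascPochhammer ℂ k).eval ((n : ℂ) + 1) = (n + k).factorial / n.factorial := by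
  have h1 := ascPochhammer_nat_eq_natCast_ascFactorial ℂ (n + 1) k
  rw [eq_div_iff (by exact_mod_cast n.factorial_ne_zero), mul_comm]
  push_cast at h1
  rw [h1]
  exact_mod_cast Nat.factorial_mul_ascFactorial n k

/-- The normalized coefficients of the Rankin–Cohen operator. -/
def rcSeq (lam₁ lam₂ : ℂ) (a l : ℕ) : ℂ :=
  (-1) ^ l * (ascPochhammer ℂ l).eval (lam₁ + a - l) * (ascPochhammer ℂ (a - l)).eval (lam₂ + l)

theorem RC_eq_bidiff (lam₁ lam₂ : ℂ) (a : ℕ) : RC lam₁ lam₂ a = bidiff a (rcSeq lam₁ lam₂ a) := by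
  refine Finset.sum_congr rfl fun l _ => ?_
  rw [jet]
  congr 1
  rw [coeff, rcSeq]
  ring

theorem recurrence_rcSeq (lam₁ lam₂ : ℂ) (a : ℕ) :
    Recurrence lam₁ lam₂ a (rcSeq lam₁ lam₂ a) := by
  intro n hn
  obtain ⟨d, rfl⟩ : ∃ d, a = n + 1 + d := ⟨a - (n + 1), by omega⟩
  simp only [rcSeq]
  rw [show n + 1 + d - n = d + 1 by omega, show n + 1 + d - (n + 1) = d by omega,
    ascPochhammer_eval_succ_left d, ascPochhammer_eval_succ_left n]
  push_cast
  rw [show lam₁ + (n + 1 + d) - (n + 1) + 1 = lam₁ + (n + 1 + d) - n by ring,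
    show lam₂ + (n + 1 : ℂ) = lam₂ + n + 1 by ring]
  ring

theorem RC_mem_intertwiners {lam₁ lam₂ lam₃ : ℂ} {a : ℕ}
    (h3 : lam₃ - lam₁ - lam₂ = 2 * (a : ℂ)) : RC lam₁ lam₂ a ∈ intertwiners lam₁ lam₂ lam₃ := by
  rw [RC_eq_bidiff]
  exact bidiff_mem_intertwiners h3 (recurrence_rcSeq _ _ _)

theorem bidiff_eq_zero_iff {a : ℕ} {b : ℕ → ℂ} : bidiff a b = 0 ↔ ∀ l ≤ a, b l = 0 := by
  have h0 : bidiff a 0 = 0 := by simp [bidiff]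
  constructor
  · intro h l hl
    exact bidiff_injective (b' := 0) (h.trans h0.symm) hl
  · intro h
    rw [← h0]
    exact bidiff_congr h

theorem intertwiners_eq_span_RC {lam₁ lam₂ lam₃ : ℂ} {a : ℕ}
    (h3 : lam₃ - lam₁ - lam₂ = 2 * (a : ℂ)) (h : RC lam₁ lam₂ a ≠ 0) :
    intertwiners lam₁ lam₂ lam₃ = Submodule.span ℂ {RC lam₁ lam₂ a} := by
  refine le_antisymm (fun T hT => ?_) ?_
  · obtain ⟨b, rfl, hb⟩ := eq_bidiff_of_mem_intertwiners hT h3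
    rw [RC_eq_bidiff] at h
    rw [RC_eq_bidiff]
    -- At an index `l` with nonzero coefficient no factor vanishes that is needed to propagate a zero
    -- at `l` downwards and upwards.
    obtain ⟨l, hl, hl0⟩ : ∃ l ≤ a, rcSeq lam₁ lam₂ a l ≠ 0 := by
      by_contra! hc
      exact h (bidiff_eq_zero_iff.2 hc)
    have h1 : (ascPochhammer ℂ l).eval (lam₁ + a - l) ≠ 0 := fun h => hl0 (by simp [rcSeq, h])
    have h2 : (ascPochhammer ℂ (a - l)).eval (lam₂ + l) ≠ 0 := fun h => hl0 (by simp [rcSeq, h])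
    rw [Ne, ascPochhammer_eval_eq_zero_iff] at h1 h2
    have hp (n : ℕ) (hn : n < l) : lam₁ + a - 1 - n ≠ 0 := fun h => h1 ⟨l - 1 - n, by omega, by
      rw [Nat.sub_sub, Nat.cast_sub (by omega)]
      push_cast
      linear_combination h⟩
    have hq (n : ℕ) (hn : l ≤ n) (hn' : n < a) : lam₂ + n ≠ 0 := fun h => h2 ⟨n - l, by omega, by
      rw [Nat.cast_sub hn]
      linear_combination h⟩
    set c : ℂ := b l / rcSeq lam₁ lam₂ a l with hc
    have hr : Recurrence lam₁ lam₂ a (b + (-c) • rcSeq lam₁ lam₂ a) :=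
      hb.add ((recurrence_rcSeq _ _ _).smul _)
    have hz : (b + (-c) • rcSeq lam₁ lam₂ a) l = 0 := by
      simp only [Pi.add_apply, Pi.smul_apply, smul_eq_mul, hc]
      field_simp
      ring
    refine Submodule.mem_span_singleton.2 ⟨c, ?_⟩
    rw [← bidiff_smul]
    refine bidiff_congr fun n hn => ?_
    have hn0 : (b + (-c) • rcSeq lam₁ lam₂ a) n = 0 := by
      rcases le_total n l with h | h
      · exact hr.eq_zero_of_le hl hz hp h
      · exact hr.eq_zero_of_ge le_rfl hz hq h hn
    simp only [Pi.add_apply, Pi.smul_apply, smul_eq_mul] at hn0 ⊢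
    linear_combination -hn0
  · rw [Submodule.span_singleton_le_iff_mem]
    exact RC_mem_intertwiners h3

/-- The Rankin–Cohen operator vanishes exactly when both coefficients of the recurrence vanish
somewhere, the first one not after the second one. -/
theorem RC_eq_zero_iff {lam₁ lam₂ : ℂ} {a : ℕ} :
    RC lam₁ lam₂ a = 0 ↔
      ∃ j i : ℕ, j ≤ i ∧ i < a ∧ lam₁ = (j : ℂ) + 1 - a ∧ lam₂ = -(i : ℂ) := by
  rw [RC_eq_bidiff, bidiff_eq_zero_iff]
  constructor
  · intro h
    have h0 := h 0 (Nat.zero_le a)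
    have ha := h a le_rfl
    simp only [rcSeq, mul_eq_zero, ascPochhammer_eval_eq_zero_iff, pow_eq_zero_iff', neg_eq_zero,
      one_ne_zero, false_and, false_or, Nat.not_lt_zero, exists_false, Nat.sub_zero,
      Nat.sub_self, or_false, Nat.cast_zero, add_zero, add_sub_cancel_right] at h0 ha
    obtain ⟨i, hi, hi2⟩ := h0
    obtain ⟨k, hk, hk2⟩ := ha
    have hj : ((a - 1 - k : ℕ) : ℂ) = a - 1 - k := by
      rw [Nat.sub_sub, Nat.cast_sub (by omega)]
      push_cast
      ring
    refine ⟨a - 1 - k, i, ?_, hi, ?_, ?_⟩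
    · -- If `i < j`, the coefficient with index `j` is nonzero.
      by_contra! hij
      have hl := h (a - 1 - k) (by omega)
      simp only [rcSeq, mul_eq_zero, ascPochhammer_eval_eq_zero_iff, pow_eq_zero_iff', neg_eq_zero,
        one_ne_zero, false_and, false_or] at hl
      rcases hl with ⟨k', -, hk'⟩ | ⟨k', -, hk'⟩
      · rw [hj] at hk'
        have : ((k' + 1 : ℕ) : ℂ) = 0 := by
          push_cast
          linear_combination hk' - hk2
        exact absurd this (Nat.cast_ne_zero.2 (Nat.succ_ne_zero _))
      · have : ((k' + (a - 1 - k) : ℕ) : ℂ) = (i : ℂ) := by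
          rw [Nat.cast_add]
          linear_combination hk' - hi2
        have : k' + (a - 1 - k) = i := by exact_mod_cast this
        omega
    · rw [hj]
      linear_combination hk2
    · linear_combination hi2
  · rintro ⟨j, i, hji, hia, rfl, rfl⟩ l hl
    rcases lt_or_ge j l with h | h
    · have : (ascPochhammer ℂ l).eval ((j : ℂ) + 1 - a + a - l) = 0 :=
        (ascPochhammer_eval_eq_zero_iff _ _).2 ⟨l - j - 1, by omega, by
          rw [Nat.sub_sub, Nat.cast_sub (by omega)]; push_cast; ring⟩
      rw [rcSeq, this, mul_zero, zero_mul]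
    · have : (ascPochhammer ℂ (a - l)).eval (-(i : ℂ) + l) = 0 :=
        (ascPochhammer_eval_eq_zero_iff _ _).2 ⟨i - l, by omega, by
          rw [Nat.cast_sub (by omega)]; ring⟩
      rw [rcSeq, this, mul_zero]

theorem mem_OmegaSing_iff {lam₁ lam₂ lam₃ : ℂ} {a : ℕ}
    (h3 : lam₃ - lam₁ - lam₂ = 2 * (a : ℂ)) :
    (lam₁, lam₂, lam₃) ∈ OmegaSing ↔
      ∃ j i : ℕ, j ≤ i ∧ i < a ∧ lam₁ = (j : ℂ) + 1 - a ∧ lam₂ = -(i : ℂ) := by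
  constructor
  · rintro ⟨-, l₁, l₂, l₃, he, h1, h2⟩
    simp only [Prod.mk.injEq] at he
    obtain ⟨rfl, rfl, rfl⟩ := he
    have h4 : l₃ - l₁ - l₂ = 2 * (a : ℤ) := by exact_mod_cast h3
    have h5 := abs_le.1 (show |l₁ - l₂| ≤ l₃ - 2 by linarith)
    obtain ⟨j, hj⟩ := Int.eq_ofNat_of_zero_le (show 0 ≤ l₁ + a - 1 by omega)
    obtain ⟨i, hi⟩ := Int.eq_ofNat_of_zero_le (show 0 ≤ -l₂ by omega)
    refine ⟨j, i, by omega, by omega, ?_, ?_⟩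
    · have : l₁ = j + 1 - a := by omega
      rw [this]; push_cast; ring
    · have : l₂ = -(i : ℤ) := by omega
      rw [this]; push_cast; ring
  · rintro ⟨j, i, hji, hia, rfl, rfl⟩
    refine ⟨⟨a, h3⟩, j + 1 - a, -i, j + 1 + a - i, ?_, ?_, ?_⟩
    · simp only [Prod.mk.injEq]
      push_cast
      exact ⟨rfl, rfl, by linear_combination h3⟩
    · have : |(j : ℤ) + 1 - a - -i| ≤ j + 1 + a - i - 2 := abs_le.2 ⟨by omega, by omega⟩
      linarith
    · omega

/-! ### The singular parameters -/

/-- Precomposition with `∂₁^m`. This needs `∂₁` and `∂₂` to commute, which is checked on products of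
one-variable functions and extended by density. -/
theorem jet_comp_d1_pow (k l m : ℕ) : jet k l ∘ₗ d1 ^ m = jet (k + m) l := by
  refine LinearMap.ext fun f => hol1_ext fun z => ?_
  refine eq_of_eq_on_mono1 (A := jet k l ∘ₗ d1 ^ m)
    ((continuous_jet k l).comp (continuous_dir_pow _ m)) (continuous_jet _ _) z 0 (fun i j => ?_) f
  rw [LinearMap.comp_apply, d1_pow_tens, jet_tens, jet_tens, Function.iterate_add_apply]

theorem jet_comp_d2_pow (k l m : ℕ) : jet k l ∘ₗ d2 ^ m = jet k (l + m) := by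
  rw [jet, jet, pow_add, ← mul_assoc]
  rfl

theorem hol_sum_comp {ι : Type*} (s : Finset ι) (F : ι → Hol2 →ₗ[ℂ] Hol1) (D : Hol2 →ₗ[ℂ] Hol2) :
    (∑ i ∈ s, F i) ∘ₗ D = ∑ i ∈ s, F i ∘ₗ D :=
  LinearMap.ext fun f => by simp only [LinearMap.comp_apply, LinearMap.sum_apply]

/-- The solution of the recurrence supported on `l ≤ j` when `lam₁ = j + 1 - a`. -/
def lowSeq (lam₂ : ℂ) (a j l : ℕ) : ℂ :=
  if l ≤ j then
    a.factorial * (-1) ^ l * (ascPochhammer ℂ (j - l)).eval (lam₂ + l) / (j - l).factorial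
  else 0

/-- The solution of the recurrence supported on `l > i` when `lam₂ = -i`. -/
def highSeq (lam₁ : ℂ) (a i l : ℕ) : ℂ :=
  if i < l then
    a.factorial * (-1) ^ (l - (i + 1)) * (ascPochhammer ℂ (l - (i + 1))).eval (lam₁ + a - l) /
      (l - (i + 1)).factorial
  else 0

theorem recurrence_lowSeq {lam₁ : ℂ} (lam₂ : ℂ) {a j : ℕ} (h1 : lam₁ = (j : ℂ) + 1 - a) :
    Recurrence lam₁ lam₂ a (lowSeq lam₂ a j) := by
  intro n _
  rcases lt_trichotomy n j with h | rfl | h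
  · obtain ⟨d, rfl⟩ : ∃ d, j = n + 1 + d := ⟨j - (n + 1), by omega⟩
    rw [lowSeq, lowSeq, if_pos (by omega), if_pos (by omega), show n + 1 + d - n = d + 1 by omega,
      show n + 1 + d - (n + 1) = d by omega, ascPochhammer_eval_succ_left, Nat.factorial_succ, h1]
    have hd : (d.factorial : ℂ) ≠ 0 := by exact_mod_cast d.factorial_ne_zero
    have hd1 : (d : ℂ) + 1 ≠ 0 := by exact_mod_cast d.succ_ne_zero
    push_cast
    rw [show lam₂ + (n + 1 : ℂ) = lam₂ + n + 1 by ring]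
    field_simp
    ring
  · rw [h1, lowSeq, lowSeq, if_neg (show ¬ n + 1 ≤ n by omega)]
    ring
  · rw [lowSeq, lowSeq, if_neg (by omega), if_neg (by omega)]
    ring

theorem recurrence_highSeq (lam₁ : ℂ) {lam₂ : ℂ} {a i : ℕ} (h2 : lam₂ = -(i : ℂ)) :
    Recurrence lam₁ lam₂ a (highSeq lam₁ a i) := by
  intro n _
  rcases lt_trichotomy n i with h | rfl | h
  · rw [highSeq, highSeq, if_neg (by omega), if_neg (by omega)]
    ring
  · rw [h2, highSeq, if_neg (lt_irrefl n)]
    ring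
  · obtain ⟨d, rfl⟩ : ∃ d, n = i + 1 + d := ⟨n - (i + 1), by omega⟩
    rw [highSeq, highSeq, if_pos (by omega), if_pos (by omega),
      show i + 1 + d - (i + 1) = d by omega, show i + 1 + d + 1 - (i + 1) = d + 1 by omega,
      ascPochhammer_eval_succ_left, Nat.factorial_succ, h2]
    have hd : (d.factorial : ℂ) ≠ 0 := by exact_mod_cast d.factorial_ne_zero
    have hd1 : (d : ℂ) + 1 ≠ 0 := by exact_mod_cast d.succ_ne_zero
    push_cast
    rw [show lam₁ + a - (i + 1 + d + 1 : ℂ) + 1 = lam₁ + a - (i + 1 + d) by ring]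
    field_simp
    ring

theorem RC_comp_d1_pow {lam₁ : ℂ} (lam₂ : ℂ) {a j : ℕ} (hj : j ≤ a)
    (h1 : lam₁ = (j : ℂ) + 1 - a) :
    RC (2 - lam₁) lam₂ j ∘ₗ d1 ^ (a - j) = bidiff a (lowSeq lam₂ a j) := by
  rw [bidiff, ← Finset.sum_subset (Finset.range_subset_range.2 (show j + 1 ≤ a + 1 by omega)), RC,
    hol_sum_comp]
  · refine Finset.sum_congr rfl fun l hl => ?_
    have hl' : l ≤ j := by have := Finset.mem_range.1 hl; omega
    rw [LinearMap.smul_comp, ← jet, jet_comp_d1_pow, show j - l + (a - j) = a - l by omega]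
    congr 1
    have e : 2 - lam₁ + j - l = ((a - l : ℕ) : ℂ) + 1 := by
      rw [h1, Nat.cast_sub (hl'.trans hj)]
      ring
    rw [coeff, e, ascPochhammer_eval_natCast_succ, Nat.sub_add_cancel (hl'.trans hj), lowSeq,
      if_pos hl']
    field_simp
  · intro l _ hl
    rw [Finset.mem_range] at hl
    rw [lowSeq, if_neg (by omega), zero_div, zero_smul]

theorem RC_comp_d2_pow (lam₁ : ℂ) {lam₂ : ℂ} {a i : ℕ} (hi : i < a) (h2 : lam₂ = -(i : ℂ)) :
    RC lam₁ (2 - lam₂) (a - (i + 1)) ∘ₗ d2 ^ (i + 1) = bidiff a (highSeq lam₁ a i) := by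
  obtain ⟨c, rfl⟩ : ∃ c, a = i + 1 + c := ⟨a - (i + 1), by omega⟩
  rw [bidiff, add_assoc (i + 1) c 1, Finset.sum_range_add, Finset.sum_eq_zero, zero_add, RC,
    hol_sum_comp, Nat.add_sub_cancel_left]
  · refine Finset.sum_congr rfl fun l hl => ?_
    have hl' : l ≤ c := by have := Finset.mem_range.1 hl; omega
    rw [LinearMap.smul_comp, ← jet, jet_comp_d2_pow, show i + 1 + c - (i + 1 + l) = c - l by omega,
      add_comm l]
    congr 1
    have e : 2 - lam₂ + l = ((i + 1 + l : ℕ) : ℂ) + 1 := by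
      rw [h2]
      push_cast
      ring
    have e' : lam₁ + ((i + 1 + c : ℕ) : ℂ) - ((i + 1 + l : ℕ) : ℂ) = lam₁ + c - l := by
      push_cast
      ring
    rw [coeff, e, ascPochhammer_eval_natCast_succ, show i + 1 + l + (c - l) = i + 1 + c by omega,
      highSeq, if_pos (by omega), Nat.add_sub_cancel_left, e']
    field_simp
  · intro l hl
    rw [Finset.mem_range] at hl
    rw [highSeq, if_neg (by omega), zero_div, zero_smul]

theorem lowSeq_self_ne_zero (lam₂ : ℂ) (a j : ℕ) : lowSeq lam₂ a j j ≠ 0 := by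
  rw [lowSeq, if_pos le_rfl]
  simp [a.factorial_ne_zero]

theorem highSeq_succ_ne_zero (lam₁ : ℂ) (a i : ℕ) : highSeq lam₁ a i (i + 1) ≠ 0 := by
  rw [highSeq, if_pos (Nat.lt_succ_self i)]
  simp [a.factorial_ne_zero]

/-- For singular parameters a solution of the recurrence is determined by its values at `j` and at
`i + 1`. -/
theorem intertwiners_eq_span_pair {lam₁ lam₂ lam₃ : ℂ} {a j i : ℕ}
    (h3 : lam₃ - lam₁ - lam₂ = 2 * (a : ℂ)) (hji : j ≤ i) (hi : i < a)
    (h1 : lam₁ = (j : ℂ) + 1 - a) (h2 : lam₂ = -(i : ℂ)) :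
    intertwiners lam₁ lam₂ lam₃ =
      Submodule.span ℂ {bidiff a (lowSeq lam₂ a j), bidiff a (highSeq lam₁ a i)} := by
  refine le_antisymm (fun T hT => ?_) ?_
  · obtain ⟨b, rfl, hb⟩ := eq_bidiff_of_mem_intertwiners hT h3
    have hp (n : ℕ) (hn : n < j) : lam₁ + a - 1 - n ≠ 0 := by
      rw [h1, show (j : ℂ) + 1 - a + a - 1 - n = j - n by ring, sub_ne_zero]
      exact_mod_cast hn.ne'
    have hq (n : ℕ) (hn : n ≠ i) : lam₂ + n ≠ 0 := by
      rw [h2, neg_add_eq_sub, sub_ne_zero]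
      exact_mod_cast hn
    have hl0 := lowSeq_self_ne_zero lam₂ a j
    have hh0 := highSeq_succ_ne_zero lam₁ a i
    -- Subtract the combination that agrees with `b` at `j` and at `i + 1`; the two sequences have
    -- disjoint supports.
    set α : ℂ := b j / lowSeq lam₂ a j j with hα
    set β : ℂ := b (i + 1) / highSeq lam₁ a i (i + 1) with hβ
    set r : ℕ → ℂ := b + ((-α) • lowSeq lam₂ a j + (-β) • highSeq lam₁ a i) with hr
    have hrec : Recurrence lam₁ lam₂ a r :=
      hb.add (((recurrence_lowSeq lam₂ h1).smul _).add ((recurrence_highSeq lam₁ h2).smul _))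
    have hrn (n : ℕ) : r n = b n - α * lowSeq lam₂ a j n - β * highSeq lam₁ a i n := by
      simp only [hr, Pi.add_apply, Pi.smul_apply, smul_eq_mul]
      ring
    have hrj : r j = 0 := by
      rw [hrn, hα, div_mul_cancel₀ _ hl0, highSeq, if_neg (by omega)]
      ring
    have hri : r (i + 1) = 0 := by
      rw [hrn, hβ, div_mul_cancel₀ _ hh0, lowSeq, if_neg (by omega)]
      ring
    refine Submodule.mem_span_pair.2 ⟨α, β, ?_⟩
    rw [← bidiff_smul, ← bidiff_smul, ← bidiff_add]
    refine bidiff_congr fun n hn => ?_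
    have hn0 : r n = 0 := by
      rcases le_or_gt n j with h | h
      · exact hrec.eq_zero_of_le (by omega) hrj hp h
      rcases le_or_gt n i with h' | h'
      · exact hrec.eq_zero_of_ge hi.le hrj (fun k _ hk => hq k hk.ne) h.le h'
      · exact hrec.eq_zero_of_ge le_rfl hri (fun k hk _ => hq k (by omega)) h' hn
    rw [hrn] at hn0
    simp only [Pi.add_apply, Pi.smul_apply, smul_eq_mul]
    linear_combination -hn0
  · rw [Submodule.span_le]
    rintro T (rfl | rfl)
    · exact bidiff_mem_intertwiners h3 (recurrence_lowSeq lam₂ h1)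
    · exact bidiff_mem_intertwiners h3 (recurrence_highSeq lam₁ h2)

/-! ### Dimensions -/

theorem finrank_span_singleton_of_injective {W : Type*} [AddCommMonoid W] [Module ℂ W] {x : W}
    (h : Function.Injective fun c : ℂ => c • x) :
    Module.finrank ℂ (Submodule.span ℂ {x}) = 1 := by
  have hinj : Function.Injective (LinearMap.toSpanSingleton ℂ W x) := h
  rw [← LinearMap.range_toSpanSingleton, ← (LinearEquiv.ofInjective _ hinj).finrank_eq]
  exact Module.finrank_self ℂ

theorem finrank_span_pair_of_injective {W : Type*} [AddCommMonoid W] [Module ℂ W] {x y : W}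
    (h : Function.Injective fun c : ℂ × ℂ => c.1 • x + c.2 • y) :
    Module.finrank ℂ (Submodule.span ℂ {x, y}) = 2 := by
  have hinj : Function.Injective
      ((LinearMap.toSpanSingleton ℂ W x).coprod (LinearMap.toSpanSingleton ℂ W y)) := h
  rw [Submodule.span_insert, ← LinearMap.range_toSpanSingleton, ← LinearMap.range_toSpanSingleton,
    ← LinearMap.range_coprod, ← (LinearEquiv.ofInjective _ hinj).finrank_eq]
  simp

theorem finrank_intertwiners_eq_one {lam₁ lam₂ lam₃ : ℂ} {a : ℕ}
    (h3 : lam₃ - lam₁ - lam₂ = 2 * (a : ℂ)) (h : RC lam₁ lam₂ a ≠ 0) :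
    Module.finrank ℂ (intertwiners lam₁ lam₂ lam₃) = 1 := by
  rw [intertwiners_eq_span_RC h3 h]
  refine finrank_span_singleton_of_injective fun s t hst => ?_
  rw [RC_eq_bidiff, Ne, bidiff_eq_zero_iff] at h
  push Not at h
  obtain ⟨l, hl, hl0⟩ := h
  simp only [RC_eq_bidiff, ← bidiff_smul] at hst
  exact mul_right_cancel₀ hl0 (bidiff_injective hst hl)

theorem finrank_intertwiners_eq_two {lam₁ lam₂ lam₃ : ℂ} {a : ℕ}
    (h3 : lam₃ - lam₁ - lam₂ = 2 * (a : ℂ)) (h : RC lam₁ lam₂ a = 0) :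
    Module.finrank ℂ (intertwiners lam₁ lam₂ lam₃) = 2 := by
  obtain ⟨j, i, hji, hi, h1, h2⟩ := RC_eq_zero_iff.1 h
  rw [intertwiners_eq_span_pair h3 hji hi h1 h2]
  refine finrank_span_pair_of_injective fun s t hst => ?_
  simp only [← bidiff_smul, ← bidiff_add] at hst
  have hj := bidiff_injective hst (show j ≤ a by omega)
  have hi' := bidiff_injective hst (show i + 1 ≤ a by omega)
  simp only [Pi.add_apply, Pi.smul_apply, smul_eq_mul] at hj hi'
  rw [show highSeq lam₁ a i j = 0 from if_neg (by omega), mul_zero, mul_zero, add_zero,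
    add_zero] at hj
  rw [show lowSeq lam₂ a j (i + 1) = 0 from if_neg (by omega), mul_zero, mul_zero, zero_add,
    zero_add] at hi'
  exact Prod.ext (mul_right_cancel₀ (lowSeq_self_ne_zero _ _ _) hj)
    (mul_right_cancel₀ (highSeq_succ_ne_zero _ _ _) hi')

end RankinCohen

end

open RankinCohen
theorem theorem2p3 (lam₁ lam₂ lam₃ : ℂ) :
    (intertwiners lam₁ lam₂ lam₃ ≠ ⊥ ↔ (lam₁, lam₂, lam₃) ∈ Omega) ∧
    (∀ a : ℕ, lam₃ - lam₁ - lam₂ = 2 * (a : ℂ) →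
      ((Module.finrank ℂ (intertwiners lam₁ lam₂ lam₃) = 1 ↔ RC lam₁ lam₂ a ≠ 0) ∧
        (RC lam₁ lam₂ a ≠ 0 ↔ (lam₁, lam₂, lam₃) ∉ OmegaSing) ∧
        ((lam₁, lam₂, lam₃) ∉ OmegaSing →
          intertwiners lam₁ lam₂ lam₃ = Submodule.span ℂ {RC lam₁ lam₂ a})) ∧
      ((Module.finrank ℂ (intertwiners lam₁ lam₂ lam₃) = 2 ↔ RC lam₁ lam₂ a = 0) ∧
        (RC lam₁ lam₂ a = 0 ↔ (lam₁, lam₂, lam₃) ∈ OmegaSing) ∧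
        ((lam₁, lam₂, lam₃) ∈ OmegaSing →
          ∃ m₁ m₂ a₁ a₂ : ℕ,
            (m₁ : ℂ) = 1 - lam₁ ∧ (m₂ : ℂ) = 1 - lam₂ ∧
            lam₃ - (2 - lam₁) - lam₂ = 2 * (a₁ : ℂ) ∧
            lam₃ - lam₁ - (2 - lam₂) = 2 * (a₂ : ℂ) ∧
            intertwiners lam₁ lam₂ lam₃ =
              Submodule.span ℂ {RC (2 - lam₁) lam₂ a₁ ∘ₗ d1 ^ m₁,
                RC lam₁ (2 - lam₂) a₂ ∘ₗ d2 ^ m₂}))) ∧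
    (∀ T ∈ intertwiners lam₁ lam₂ lam₃, IsDifferential T) := by
  have hsing (a : ℕ) (h3 : lam₃ - lam₁ - lam₂ = 2 * (a : ℂ)) :
      RC lam₁ lam₂ a = 0 ↔ (lam₁, lam₂, lam₃) ∈ OmegaSing :=
    RC_eq_zero_iff.trans (mem_OmegaSing_iff h3).symm
  refine ⟨⟨fun h => ?_, ?_⟩, fun a h3 =>
    ⟨⟨⟨fun h h0 => ?_, finrank_intertwiners_eq_one h3⟩, (hsing a h3).not,
      fun h => intertwiners_eq_span_RC h3 ((hsing a h3).not.2 h)⟩,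
    ⟨fun h => ?_, finrank_intertwiners_eq_two h3⟩, hsing a h3, fun h => ?_⟩, fun T hT => ?_⟩
  · by_contra hO
    exact h ((Submodule.eq_bot_iff _).2 fun T hT => eq_zero_of_mem_intertwiners hT hO)
  · rintro ⟨a, h3⟩ h
    have hfin : Module.finrank ℂ (intertwiners lam₁ lam₂ lam₃) = 0 := by
      rw [h]
      exact finrank_bot ℂ _
    by_cases h0 : RC lam₁ lam₂ a = 0
    · exact two_ne_zero ((finrank_intertwiners_eq_two h3 h0).symm.trans hfin)
    · exact one_ne_zero ((finrank_intertwiners_eq_one h3 h0).symm.trans hfin)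
  · have := finrank_intertwiners_eq_two h3 h0
    omega
  · by_contra h0
    have := finrank_intertwiners_eq_one h3 h0
    omega
  · obtain ⟨j, i, hji, hi, h1, h2⟩ := (mem_OmegaSing_iff h3).1 h
    refine ⟨a - j, i + 1, j, a - (i + 1), ?_, ?_, ?_, ?_, ?_⟩
    · rw [Nat.cast_sub (by omega), h1]
      ring
    · rw [h2]
      push_cast
      ring
    · linear_combination h3 + 2 * h1
    · rw [Nat.cast_sub (by omega)]
      push_cast
      linear_combination h3 + 2 * h2
    · rw [RC_comp_d1_pow lam₂ (by omega) h1, RC_comp_d2_pow lam₁ hi h2]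
      exact intertwiners_eq_span_pair h3 hji hi h1 h2
  · by_cases hO : (lam₁, lam₂, lam₃) ∈ Omega
    · obtain ⟨a, h3⟩ := hO
      obtain ⟨b, rfl, -⟩ := eq_bidiff_of_mem_intertwiners hT h3
      exact isDifferential_bidiff a b
    · rw [eq_zero_of_mem_intertwiners hT hO]
      exact ⟨0, fun _ _ => 0, fun f z => by simp⟩
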